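/- Fix an integer $k\ge 1$ and real numbers $\lambda>0$, $\theta>0$. For a process $Z(t)$, $t\ge 0$, a stationary solution of $$dX(t)=-\lambda X(t)\,dt+dZ(\lambda t),\qquad t\ge 0,\qquad (\ast)$$ is a strictly stationary real-valued process $X(t)$, $t\ge0$, on the same probability space such that $X(0)$ is independent of the process $Z$ and, almost surely, $X$ has locally integrable paths and $X(t)=X(0)-\lambda\int_0^tX(s)\,ds+Z(\lambda t)-Z(0)$ for all $t\ge 0$. For $a>0$, a Dickman Ornstein–Uhlenbeck (DOU) process with parameters $\theta$ and $a$ (and mean-reversion parameter $\lambda$) is a stationary solution of $(\ast)$ with $Z=aN$, where $N$ is a homogeneous Poisson process with rate $\theta$. The Poisson process of order $k$ is $N^{(k)}_\theta(t)=\sum_{i=1}^{N(t)}Y_i$, where $N$ is a homogeneous Poisson process with rate $k\theta$ and $Y_1,Y_2,\dots$ are i.i.d. uniform on $\{1,\dots,k\}$, the sequence $(Y_i)$ being independent of $N$. **Theorem.** Let $X^{(k)}(t)$, $t\ge 0$, be a stationary solution of $(\ast)$ with $Z=N^{(k)}_\theta$. If $X_{\theta,1},\dots,X_{\theta,k}$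 are independent processes on some probability space, $X_{\theta,j}$ being a DOU process with parameters $\theta$ and $a_j=j$ (and the same $\lambda$), then the processes $\{X^{(k)}(t),\,t\ge 0\}$ and $\{\sum_{j=1}^kX_{\theta,j}(t),\,t\ge 0\}$ have the same finite-dimensional distributions. Moreover $X^{(k)}(t)$ is square integrable, and for all $t,\tau\ge 0$ $$\mathbb{E}X^{(k)}(t)=\theta\,\frac{k(k+1)}2,\qquad \mathrm{Cov}\bigl(X^{(k)}(t),X^{(k)}(t+\tau)\bigr)=\frac{\theta}{2}\,\frac{k(k+1)(2k+1)}{6}\,e^{-\lambda\tau}.$$ -/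

import Mathlib

open MeasureTheory ProbabilityTheory
open scoped NNReal ENNReal

namespace DickmanOU

/-- Two real-valued processes, possibly on different probability spaces, have the same
finite-dimensional distributions: for every finite set `I` of times the vectors
`(X t)_{t ∈ I}` and `(Y t)_{t ∈ I}` have the same law. -/
def SameFDD {Ω Ω' : Type*} [MeasurableSpace Ω] [MeasurableSpace Ω']
    (X : ℝ≥0 → Ω → ℝ) (P : Measure Ω) (Y : ℝ≥0 → Ω' → ℝ) (Q : Measure Ω') : Prop :=
  ∀ I : Finset ℝ≥0,
    IdentDistrib (fun ω ↦ I.restrict (X · ω)) (fun ω ↦ I.restrict (Y · ω)) P Q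

/-- Strict stationarity: the finite-dimensional distributions are invariant under time shifts. -/
def IsStrictlyStationary {Ω : Type*} [MeasurableSpace Ω]
    (X : ℝ≥0 → Ω → ℝ) (P : Measure Ω) : Prop :=
  ∀ h : ℝ≥0, SameFDD (fun t ↦ X (t + h)) P X P

/-- `N` is a homogeneous Poisson process with rate `r`: a counting process that starts at `0` and
has independent increments, with `N t - N s` Poisson distributed with mean `r (t - s)`.
Increments are taken in `ℝ`, so that no truncated subtraction occurs. -/
structure IsPoissonProcess {Ω : Type*} [MeasurableSpace Ω]
    (r : ℝ≥0) (N : ℝ≥0 → Ω → ℕ) (P : Measure Ω) : Prop where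
  measurable : ∀ t, Measurable (N t)
  zero : ∀ᵐ ω ∂P, N 0 ω = 0
  indepIncrements : HasIndepIncrements (fun t ω ↦ (N t ω : ℝ)) P
  increment_law : ∀ s t : ℝ≥0, s ≤ t →
    HasLaw (fun ω ↦ (N t ω : ℝ) - (N s ω : ℝ))
      ((poissonMeasure (r * (t - s))).map (Nat.cast : ℕ → ℝ)) P
  paths : ∀ᵐ ω ∂P, Monotone (fun t ↦ N t ω) ∧
    ∀ t, ContinuousWithinAt (fun s ↦ N s ω) (Set.Ici t) t

/-- `Z` is a Poisson process of order `k` with parameter `θ`: `Z t = ∑_{i = 1}^{N t} Y_i`, where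
`N` is a Poisson process with rate `k θ` and the `Y_i` are i.i.d. uniform on `{1, …, k}`,
the sequence `Y` being independent of the process `N` (here `Y i` stands for `Y_{i+1}`). -/
def IsPoissonProcessOfOrder {Ω : Type*} [MeasurableSpace Ω]
    (k : ℕ) (θ : ℝ≥0) (Z : ℝ≥0 → Ω → ℝ) (P : Measure Ω) : Prop :=
  ∃ (N : ℝ≥0 → Ω → ℕ) (Y : ℕ → Ω → ℕ),
    IsPoissonProcess ((k : ℝ≥0) * θ) N P ∧
    (∀ i, Measurable (Y i)) ∧
    (∀ i, HasLaw (Y i) (uniformOn (Set.Icc 1 k)) P) ∧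
    iIndepFun Y P ∧
    IndepFun (fun ω t ↦ N t ω) (fun ω i ↦ Y i ω) P ∧
    ∀ t ω, Z t ω = ∑ i ∈ Finset.range (N t ω), (Y i ω : ℝ)

/-- `X` is a (strictly) stationary solution of `dX(t) = -lam X(t) dt + dZ(lam t)`, `t ≥ 0`:
a strictly stationary process whose initial value is independent of the driving process `Z`, and
which almost surely has locally integrable paths and satisfies, for all `t ≥ 0`,
`X(t) = X(0) - lam ∫₀ᵗ X(s) ds + (Z(lam t) - Z(0))`. -/
structure IsStationaryOU {Ω : Type*} [MeasurableSpace Ω]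
    (lam : ℝ≥0) (Z X : ℝ≥0 → Ω → ℝ) (P : Measure Ω) : Prop where
  measurable : ∀ t, Measurable (X t)
  stationary : IsStrictlyStationary X P
  indep_initial : IndepFun (X 0) (fun ω t ↦ Z t ω) P
  sde : ∀ᵐ ω ∂P, ∀ t : ℝ≥0,
    IntervalIntegrable (fun s : ℝ ↦ X s.toNNReal ω) volume 0 t ∧
    X t ω = X 0 ω - lam * (∫ s in (0 : ℝ)..t, X s.toNNReal ω) + (Z (lam * t) ω - Z 0 ω)

/-- `X` is a Dickman Ornstein–Uhlenbeck process with parameters `θ`, `a` and mean-reversion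
parameter `lam`: a stationary solution of `dX(t) = -lam X(t) dt + dN_{θ,a}(lam t)`, where
`N_{θ,a} = a N` is a homogeneous Poisson process with rate `θ` and jumps of size `a`. -/
def IsDOU {Ω : Type*} [MeasurableSpace Ω]
    (lam θ : ℝ≥0) (a : ℝ) (X : ℝ≥0 → Ω → ℝ) (P : Measure Ω) : Prop :=
  ∃ N : ℝ≥0 → Ω → ℕ, IsPoissonProcess θ N P ∧
    IsStationaryOU lam (fun t ω ↦ a * (N t ω : ℝ)) X P

end DickmanOU

/-!
# Superposition and moments of stationary Ornstein–Uhlenbeck processes with Poisson noise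

**Drivers.** A Poisson process of order `k` and the processes `a N` with `N` Poisson are both
increasing Lévy processes (`IsSubordinator`), described here by their exponents: for the Poisson
process of order `k` it is the sum over `j = 1, …, k` of the exponents `θ (e^{iju} - 1)` of `j N`
(`IsPoissonProcessOfOrder.isSubordinator`, `IsPoissonProcess.isSubordinator`). The theorem is the
statement that this additivity passes to the stationary solutions.

**Explicit solution.** A path of a solution satisfies
`X t = e^{-lam t} X 0 + ∫₀ᵗ e^{-lam (t - s)} dZ(lam s)`, the integral being a limit of
Riemann–Stieltjes sums over regular grids (`tendsto_riemann_sum`). These sums are linear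
combinations of independent increments of `Z`, independent of `X 0`. Hence the joint
characteristic function of `X 0` and the noise terms `X t - e^{-lam t} X 0` factors, and that of the
noise is a limit of exponentials of expressions that are linear in the exponent of the driver
(`IsStationaryOU.tendsto_charFun`).

**Equality of the finite-dimensional distributions.** By this linearity the characteristic function
of the noise of `X` is the product of those of the noises of the summands. By stationarity, `X 0`
has the law of `X t = e^{-lam t} X 0 + noise`; letting `t → ∞` shows that the law of `X 0` is the limit
law of the noise (`IsStationaryOU.tendsto_charFun_noise`), so its characteristic function is a
product as well. The two factors together give `IsStationaryOU.sameFDD_sum`.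

**Moments.** The Riemann sums have the law of a linear combination of independent Poisson variables,
and they are dominated by one increment of `Z`, so mean and variance of the noise are limits of
explicit sums (`IsStationaryOU.moments_noise`). The second moments of the noise being bounded in
time, `X 0` is square integrable (`IsStationaryOU.memLp_zero`), and mean, variance and covariances
of `X` follow from stationarity and from the independence of `X 0` and the noise
(`IsStationaryOU.moments`).
-/

namespace DickmanOU

open Filter Topology Complex

/-! ### Generating functions of Poisson increments -/

lemma integral_pow_poissonMeasure (r : ℝ≥0) (η : ℂ) :
    ∫ n, η ^ n ∂(poissonMeasure r) = cexp (r * (η - 1)) := by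
  rw [integral_poissonMeasure r]
  have h := (NormedSpace.expSeries_div_hasSum_exp ((r : ℂ) * η)).mul_left ((Real.exp (-r) : ℝ) : ℂ)
  rw [← exp_eq_exp_ℂ] at h
  have h2 : ((Real.exp (-r) : ℝ) : ℂ) * cexp (r * η) = cexp (r * (η - 1)) := by
    rw [ofReal_exp, ← Complex.exp_add]
    push_cast
    ring_nf
  rw [← h2, ← h.tsum_eq]
  refine tsum_congr fun n ↦ ?_
  rw [real_smul]
  push_cast
  rw [mul_pow]
  ring

section Poisson

variable {Ω : Type*} [MeasurableSpace Ω] {P : Measure Ω} {r : ℝ≥0} {N : ℝ≥0 → Ω → ℕ}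

lemma IsPoissonProcess.integral_pow_sub (hN : IsPoissonProcess r N P) {s t : ℝ≥0} (hst : s ≤ t)
    (η : ℂ) : ∫ ω, η ^ (N t ω - N s ω) ∂P = cexp (((r * (t - s) : ℝ≥0) : ℂ) * (η - 1)) := by
  have hlaw := hN.increment_law s t hst
  have hf : Measurable fun x : ℝ ↦ η ^ ⌊x⌋₊ :=
    (measurable_of_countable (fun n : ℕ ↦ η ^ n)).comp Nat.measurable_floor
  have h1 : ∫ ω, η ^ (N t ω - N s ω) ∂P = ∫ ω, η ^ ⌊(N t ω : ℝ) - N s ω⌋₊ ∂P := by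
    refine integral_congr_ae ?_
    filter_upwards [hN.paths] with ω hω
    rw [← Nat.cast_sub (hω.1 hst), Nat.floor_natCast]
  rw [h1, ← integral_map (f := fun x : ℝ ↦ η ^ ⌊x⌋₊) hlaw.aemeasurable hf.aestronglyMeasurable,
    hlaw.map_eq, integral_map (by fun_prop) hf.aestronglyMeasurable,
    ← integral_pow_poissonMeasure]
  simp

/-- The joint probability generating function of the increments of a Poisson process. -/
lemma IsPoissonProcess.integral_prod_pow_sub (hN : IsPoissonProcess r N P) {t : ℕ → ℝ≥0}
    (ht : Monotone t) (η : ℕ → ℂ) (m : ℕ) :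
    ∫ ω, ∏ l ∈ Finset.range m, η l ^ (N (t (l + 1)) ω - N (t l) ω) ∂P =
      ∏ l ∈ Finset.range m, cexp (((r * (t (l + 1) - t l) : ℝ≥0) : ℂ) * (η l - 1)) := by
  have hind := (hN.indepIncrements.nat ht).precomp (g := fun l : Fin m ↦ (l : ℕ))
    Fin.val_injective
  have hf : ∀ z : ℂ, Measurable fun x : ℝ ↦ z ^ ⌊x⌋₊ := fun z ↦
    (measurable_of_countable (fun n : ℕ ↦ z ^ n)).comp Nat.measurable_floor
  have hmeas : ∀ s : ℝ≥0, Measurable fun ω ↦ (N s ω : ℝ) := fun s ↦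
    (measurable_of_countable (fun n : ℕ ↦ (n : ℝ))).comp (hN.measurable s)
  have key := hind.integral_fun_prod_comp (f := fun (l : Fin m) x ↦ η l ^ ⌊x⌋₊)
    (fun l ↦ Measurable.aemeasurable (Measurable.fun_sub (hmeas _) (hmeas _)))
    (fun l ↦ (hf _).aestronglyMeasurable)
  have hcast : ∀ᵐ ω ∂P, ∀ l, ⌊(N (t (l + 1)) ω : ℝ) - N (t l) ω⌋₊ =
      N (t (l + 1)) ω - N (t l) ω := by
    filter_upwards [hN.paths] with ω hω l
    rw [← Nat.cast_sub (hω.1 (ht (Nat.le_succ l))), Nat.floor_natCast]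
  simp_rw [Finset.prod_range]
  convert key using 1
  · refine integral_congr_ae ?_
    filter_upwards [hcast] with ω hω
    simp only [hω]
  · refine Finset.prod_congr rfl fun l _ ↦ ?_
    rw [← hN.integral_pow_sub (ht (Nat.le_succ _))]
    refine integral_congr_ae ?_
    filter_upwards [hcast] with ω hω
    simp only [hω]

end Poisson

/-! ### Increasing Lévy processes and their exponents -/

/-- An increasing Lévy process with characteristic exponent `g`: almost surely the paths are
nondecreasing and right-continuous, and along every regular grid the increments have the joint
characteristic function of independent variables, each with characteristic function
`exp (δ g)` for grid spacing `δ`. Only regular grids enter, because they suffice for the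
Riemann sums below. The paths are not required to start at `0`. -/
structure IsSubordinator {Ω : Type*} [MeasurableSpace Ω]
    (g : ℝ → ℂ) (Z : ℝ≥0 → Ω → ℝ) (P : Measure Ω) : Prop where
  measurable : ∀ t, Measurable (Z t)
  charFun_grid : ∀ (δ : ℝ≥0) (m : ℕ) (c : ℕ → ℝ),
    ∫ ω, cexp ((∑ l ∈ Finset.range m,
        c l * (Z (((l + 1 : ℕ) : ℝ≥0) * δ) ω - Z ((l : ℝ≥0) * δ) ω) : ℝ) * I) ∂P =
      cexp (δ * ∑ l ∈ Finset.range m, g (c l))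
  paths : ∀ᵐ ω ∂P, Monotone (fun t ↦ Z t ω) ∧
    ∀ t, ContinuousWithinAt (fun s ↦ Z s ω) (Set.Ici t) t

lemma monotone_grid (δ : ℝ≥0) : Monotone fun l : ℕ ↦ (l : ℝ≥0) * δ := fun a b hab ↦ by
  dsimp only
  gcongr

lemma grid_sub (δ : ℝ≥0) (l : ℕ) : ((l + 1 : ℕ) : ℝ≥0) * δ - (l : ℝ≥0) * δ = δ := by
  rw [← tsub_mul]
  simp

section Subordinators

variable {Ω : Type*} [MeasurableSpace Ω] {P : Measure Ω}

/-- The characteristic exponent of the Poisson process with rate `θ` and jumps of size `a`. -/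
noncomputable def poissonExponent (θ : ℝ≥0) (a : ℝ) (u : ℝ) : ℂ :=
  θ * (cexp ((u * a : ℝ) * I) - 1)

lemma IsPoissonProcess.isSubordinator {θ : ℝ≥0} {N : ℝ≥0 → Ω → ℕ} (hN : IsPoissonProcess θ N P)
    {a : ℝ} (ha : 0 ≤ a) :
    IsSubordinator (poissonExponent θ a) (fun t ω ↦ a * (N t ω : ℝ)) P where
  measurable t := ((measurable_of_countable (fun n : ℕ ↦ (n : ℝ))).comp
    (hN.measurable t)).const_mul a
  charFun_grid δ m c := by
    have h := hN.integral_prod_pow_sub (monotone_grid δ)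
      (fun l ↦ cexp ((c l * a : ℝ) * I)) m
    simp only [grid_sub] at h
    rw [Finset.mul_sum, Complex.exp_sum]
    convert h using 1
    · refine integral_congr_ae ?_
      filter_upwards [hN.paths] with ω hω
      rw [ofReal_sum, Finset.sum_mul, Complex.exp_sum]
      refine Finset.prod_congr rfl fun l _ ↦ ?_
      rw [← Complex.exp_nat_mul, Nat.cast_sub (hω.1 (monotone_grid δ (Nat.le_succ l)))]
      congr 1
      push_cast
      ring
    · refine Finset.prod_congr rfl fun l _ ↦ ?_
      simp only [poissonExponent]
      congr 1
      push_cast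
      ring
  paths := by
    filter_upwards [hN.paths] with ω hω
    refine ⟨fun s t hst ↦ by have := hω.1 hst; dsimp only at this ⊢; gcongr, fun t ↦ ?_⟩
    exact ContinuousAt.comp_continuousWithinAt (f := fun s ↦ N s ω)
      (continuous_of_discreteTopology (f := fun n : ℕ ↦ a * (n : ℝ))).continuousAt (hω.2 t)

/-- For independent `Y i` with common characteristic function `η`, the block sums
`∑_{ν l ≤ i < ν (l + 1)} Y i` have joint characteristic function `∏ η (c l) ^ (ν (l + 1) - ν l)`. -/
lemma integral_exp_block_sums [IsProbabilityMeasure P] {Y : ℕ → Ω → ℕ} (hY : ∀ i, Measurable (Y i))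
    (hind : iIndepFun Y P) {η : ℝ → ℂ}
    (hη : ∀ i c, ∫ ω, cexp ((c * (Y i ω : ℝ) : ℝ) * I) ∂P = η c)
    {ν : ℕ → ℕ} (hν : Monotone ν) (c : ℕ → ℝ) (m : ℕ) :
    ∫ ω, cexp ((∑ l ∈ Finset.range m, c l * (∑ i ∈ Finset.range (ν (l + 1)), (Y i ω : ℝ) -
        ∑ i ∈ Finset.range (ν l), (Y i ω : ℝ)) : ℝ) * I) ∂P =
      ∏ l ∈ Finset.range m, η (c l) ^ (ν (l + 1) - ν l) := by
  -- The coefficient `c l` is spread over the indices of block `l`.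
  have hb : ∃ b : ℕ → ℝ,
      (∀ y : ℕ → ℝ, ∑ l ∈ Finset.range m, c l * (∑ i ∈ Finset.range (ν (l + 1)), y i -
        ∑ i ∈ Finset.range (ν l), y i) = ∑ i ∈ Finset.Ico (ν 0) (ν m), b i * y i) ∧
      ∏ i ∈ Finset.Ico (ν 0) (ν m), η (b i) =
        ∏ l ∈ Finset.range m, η (c l) ^ (ν (l + 1) - ν l) := by
    induction m with
    | zero => exact ⟨0, by simp, by simp⟩
    | succ m ih =>
      obtain ⟨b, hb1, hb2⟩ := ih
      have h0 : ν 0 ≤ ν m := hν (Nat.zero_le m)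
      have h1 : ν m ≤ ν (m + 1) := hν (Nat.le_succ m)
      have e1 : ∀ i ∈ Finset.Ico (ν 0) (ν m), (if i < ν m then b i else c m) = b i := by
        intro i hi
        rw [if_pos (Finset.mem_Ico.1 hi).2]
      have e2 : ∀ i ∈ Finset.Ico (ν m) (ν (m + 1)), (if i < ν m then b i else c m) = c m := by
        intro i hi
        rw [if_neg (not_lt.2 (Finset.mem_Ico.1 hi).1)]
      refine ⟨fun i ↦ if i < ν m then b i else c m, fun y ↦ ?_, ?_⟩
      · rw [Finset.sum_range_succ, hb1, ← Finset.sum_Ico_consecutive _ h0 h1]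
        congr 1
        · exact Finset.sum_congr rfl fun i hi ↦ by dsimp only; rw [e1 i hi]
        · rw [← Finset.sum_Ico_eq_sub _ h1, Finset.mul_sum]
          exact Finset.sum_congr rfl fun i hi ↦ by dsimp only; rw [e2 i hi]
      · rw [Finset.prod_range_succ, ← hb2, ← Finset.prod_Ico_consecutive _ h0 h1]
        congr 1
        · exact Finset.prod_congr rfl fun i hi ↦ by dsimp only; rw [e1 i hi]
        · rw [Finset.prod_congr rfl (g := fun _ ↦ η (c m)) fun i hi ↦ by dsimp only; rw [e2 i hi]]
          simp
  obtain ⟨b, hb1, hb2⟩ := hb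
  have hprod : ∀ ω, cexp ((∑ i ∈ Finset.Ico (ν 0) (ν m), b i * (Y i ω : ℝ) : ℝ) * I) =
      ∏ i : Finset.Ico (ν 0) (ν m), cexp ((b i * (Y i ω : ℝ) : ℝ) * I) := by
    intro ω
    rw [ofReal_sum, Finset.sum_mul, Complex.exp_sum,
      Finset.prod_coe_sort (f := fun i ↦ cexp ((b i * (Y i ω : ℝ) : ℝ) * I))]
  have hind' := hind.precomp (g := fun i : Finset.Ico (ν 0) (ν m) ↦ (i : ℕ)) Subtype.val_injective
  have key := hind'.integral_fun_prod_comp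
    (f := fun (i : Finset.Ico (ν 0) (ν m)) (n : ℕ) ↦ cexp ((b i * (n : ℝ) : ℝ) * I))
    (fun i ↦ (hY i).aemeasurable) (fun i ↦ .of_discrete)
  simp_rw [hb1, hprod]
  rw [key, ← hb2, ← Finset.prod_coe_sort _ fun i ↦ η (b i)]
  exact Finset.prod_congr rfl fun i _ ↦ hη i (b i)

lemma measurable_partialSum :
    Measurable fun p : ℕ × (ℕ → ℕ) ↦ ∑ i ∈ Finset.range p.1, (p.2 i : ℝ) := by
  refine measurable_from_prod_countable_right fun n ↦ ?_
  change Measurable fun y : ℕ → ℕ ↦ ∑ i ∈ Finset.range n, (y i : ℝ)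
  refine Finset.measurable_fun_sum _ fun i _ ↦ ?_
  exact (measurable_of_countable (fun n : ℕ ↦ (n : ℝ))).comp (measurable_pi_apply i)

lemma measurable_exp_block_sums (c : ℕ → ℝ) (m : ℕ) :
    Measurable fun p : (ℕ → ℕ) × (ℕ → ℕ) ↦ cexp ((∑ l ∈ Finset.range m,
      c l * (∑ i ∈ Finset.range (p.1 (l + 1)), (p.2 i : ℝ) -
        ∑ i ∈ Finset.range (p.1 l), (p.2 i : ℝ)) : ℝ) * I) := by
  have hS : ∀ l : ℕ, Measurable fun p : (ℕ → ℕ) × (ℕ → ℕ) ↦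
      ∑ i ∈ Finset.range (p.1 l), (p.2 i : ℝ) := fun l ↦
    measurable_partialSum.comp (f := fun p : (ℕ → ℕ) × (ℕ → ℕ) ↦ (p.1 l, p.2))
      (((measurable_pi_apply l).comp measurable_fst).prodMk measurable_snd)
  have hsum : Measurable fun p : (ℕ → ℕ) × (ℕ → ℕ) ↦ ∑ l ∈ Finset.range m,
      c l * (∑ i ∈ Finset.range (p.1 (l + 1)), (p.2 i : ℝ) -
        ∑ i ∈ Finset.range (p.1 l), (p.2 i : ℝ)) :=
    Finset.measurable_fun_sum _ fun l _ ↦ ((hS (l + 1)).fun_sub (hS l)).const_mul (c l)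
  exact Complex.measurable_exp.comp ((Complex.measurable_ofReal.comp hsum).mul_const I)

lemma integral_exp_of_hasLaw_uniformOn {k : ℕ} {Y : Ω → ℕ}
    (hY : HasLaw Y (uniformOn (Set.Icc 1 k)) P) (c : ℝ) :
    ∫ ω, cexp ((c * (Y ω : ℝ) : ℝ) * I) ∂P =
      (k : ℂ)⁻¹ * ∑ j : Fin k, cexp ((c * ((j : ℝ) + 1) : ℝ) * I) := by
  rw [← integral_map (f := fun n : ℕ ↦ cexp ((c * (n : ℝ) : ℝ) * I)) hY.aemeasurable
    .of_discrete, hY.map_eq, uniformOn, ProbabilityTheory.cond, integral_smul_measure,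
    ← Finset.coe_Icc, setIntegral_finset _ ?_]
  · rw [Fin.sum_univ_eq_sum_range (fun j : ℕ ↦ cexp ((c * ((j : ℝ) + 1) : ℝ) * I)),
      Finset.range_eq_Ico, Measure.count_apply_finset]
    have h := Finset.sum_Ico_add' (fun n : ℕ ↦ cexp ((c * (n : ℝ) : ℝ) * I)) 0 k 1
    simp only [Nat.cast_add, Nat.cast_one, zero_add] at h
    rw [h, Finset.Ico_add_one_right_eq_Icc]
    simp [measureReal_def]
  · have : IsFiniteMeasure (Measure.count.restrict (Finset.Icc 1 k : Set ℕ)) := by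
      refine ⟨?_⟩
      simp
    exact Integrable.of_bound .of_discrete 1
      (.of_forall fun n ↦ (Complex.norm_exp_ofReal_mul_I _).le)

/-- A Poisson process of order `k` is a subordinator, its exponent being the sum of the exponents
of the Poisson processes with rate `θ` and jumps of size `1, …, k`. -/
lemma IsPoissonProcessOfOrder.isSubordinator [IsProbabilityMeasure P] {k : ℕ} (hk : 1 ≤ k)
    {θ : ℝ≥0} {Z : ℝ≥0 → Ω → ℝ} (hZ : IsPoissonProcessOfOrder k θ Z P) :
    IsSubordinator (fun u ↦ ∑ j : Fin k, poissonExponent θ ((j : ℝ) + 1) u) Z P := by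
  obtain ⟨N, Y, hN, hYm, hYlaw, hYind, hNY, hZeq⟩ := hZ
  have hYm' : Measurable fun ω i ↦ Y i ω := measurable_pi_lambda _ hYm
  refine ⟨fun t ↦ ?_, fun δ m c ↦ ?_, ?_⟩
  · have h := measurable_partialSum.comp ((hN.measurable t).prodMk hYm')
    rwa [show Z t = _ from funext fun ω ↦ hZeq t ω]
  · set η : ℝ → ℂ := fun c ↦ (k : ℂ)⁻¹ * ∑ j : Fin k, cexp ((c * ((j : ℝ) + 1) : ℝ) * I) with hη
    set t : ℕ → ℝ≥0 := fun l ↦ (l : ℝ≥0) * δ with ht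
    have hNt : Measurable fun ω (l : ℕ) ↦ N (t l) ω :=
      measurable_pi_lambda _ fun l ↦ hN.measurable _
    have hres : Measurable fun (f : ℝ≥0 → ℕ) (l : ℕ) ↦ f (t l) :=
      measurable_pi_lambda _ fun l ↦ measurable_pi_apply (t l)
    have hindep : IndepFun (fun ω (l : ℕ) ↦ N (t l) ω) (fun ω i ↦ Y i ω) P :=
      hNY.comp hres measurable_id
    set F : (ℕ → ℕ) × (ℕ → ℕ) → ℂ := fun p ↦ cexp ((∑ l ∈ Finset.range m,
      c l * (∑ i ∈ Finset.range (p.1 (l + 1)), (p.2 i : ℝ) -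
        ∑ i ∈ Finset.range (p.1 l), (p.2 i : ℝ)) : ℝ) * I) with hFdef
    have hF : Measurable F := measurable_exp_block_sums c m
    have hmap := (indepFun_iff_map_prod_eq_prod_map_map hNt.aemeasurable hYm'.aemeasurable).1 hindep
    have : IsProbabilityMeasure (P.map fun ω (l : ℕ) ↦ N (t l) ω) :=
      Measure.isProbabilityMeasure_map hNt.aemeasurable
    have : IsProbabilityMeasure (P.map fun ω i ↦ Y i ω) :=
      Measure.isProbabilityMeasure_map hYm'.aemeasurable
    have hFint : Integrable F ((P.map fun ω (l : ℕ) ↦ N (t l) ω).prod (P.map fun ω i ↦ Y i ω)) := by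
      refine Integrable.of_bound hF.aestronglyMeasurable 1 (.of_forall fun p ↦ ?_)
      exact (Complex.norm_exp_ofReal_mul_I _).le
    have e1 : ∫ ω, cexp ((∑ l ∈ Finset.range m,
        c l * (Z (((l + 1 : ℕ) : ℝ≥0) * δ) ω - Z ((l : ℝ≥0) * δ) ω) : ℝ) * I) ∂P =
        ∫ ω, F (fun l ↦ N (t l) ω, fun i ↦ Y i ω) ∂P := by
      simp only [hZeq, hFdef, ht]
    -- Independence of `N` and `Y` lets the jump sizes be integrated first, for fixed jump counts.
    have e2 : ∫ ω, F (fun l ↦ N (t l) ω, fun i ↦ Y i ω) ∂P =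
        ∫ ω, ∫ ω', F (fun l ↦ N (t l) ω, fun i ↦ Y i ω') ∂P ∂P := by
      rw [← integral_map (f := F) (hNt.prodMk hYm').aemeasurable hF.aestronglyMeasurable, hmap,
        integral_prod _ hFint, integral_map hNt.aemeasurable
          hF.stronglyMeasurable.integral_prod_right.aestronglyMeasurable]
      refine integral_congr_ae (.of_forall fun ω ↦ ?_)
      exact integral_map hYm'.aemeasurable (hF.comp measurable_prodMk_left).aestronglyMeasurable
    have e3 : ∫ ω, ∫ ω', F (fun l ↦ N (t l) ω, fun i ↦ Y i ω') ∂P ∂P =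
        ∫ ω, ∏ l ∈ Finset.range m, η (c l) ^ (N (t (l + 1)) ω - N (t l) ω) ∂P := by
      refine integral_congr_ae ?_
      filter_upwards [hN.paths] with ω hω
      exact integral_exp_block_sums hYm hYind (η := η)
        (fun i c ↦ integral_exp_of_hasLaw_uniformOn (hYlaw i) c)
        (ν := fun l ↦ N (t l) ω) (fun a b hab ↦ hω.1 (monotone_grid δ hab)) c m
    rw [e1, e2, e3, hN.integral_prod_pow_sub (monotone_grid δ), Finset.mul_sum, Complex.exp_sum]
    refine Finset.prod_congr rfl fun l _ ↦ ?_
    congr 1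
    have hk0 : (k : ℂ) ≠ 0 := by exact_mod_cast (by omega : k ≠ 0)
    have hsum : ∑ j : Fin k, poissonExponent θ ((j : ℝ) + 1) (c l) = θ * (k * (η (c l) - 1)) := by
      simp only [poissonExponent, hη]
      rw [← Finset.mul_sum, Finset.sum_sub_distrib, mul_sub, mul_sub, mul_inv_cancel_left₀ hk0]
      simp
      ring
    rw [hsum, grid_sub]
    push_cast
    ring
  · filter_upwards [hN.paths] with ω hω
    refine ⟨fun s t hst ↦ ?_, fun t ↦ ?_⟩
    · simp only [hZeq]
      refine Finset.sum_le_sum_of_subset_of_nonneg ?_ fun i _ _ ↦ by positivity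
      exact Finset.range_mono (hω.1 hst)
    · simp only [hZeq]
      exact ContinuousAt.comp_continuousWithinAt (f := fun s ↦ N s ω)
        (continuous_of_discreteTopology
          (f := fun n : ℕ ↦ ∑ i ∈ Finset.range n, (Y i ω : ℝ))).continuousAt (hω.2 t)

end Subordinators

/-! ### Pathwise solution of the equation -/

section GridPoints

lemma le_ceil_div (n : ℕ) (r : ℝ) : r ≤ (⌈r * (n + 1)⌉₊ : ℝ) / (n + 1) := by
  rw [le_div_iff₀ (by positivity)]
  exact Nat.le_ceil _

lemma ceil_div_le (n : ℕ) {r : ℝ} (hr : 0 ≤ r) :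
    (⌈r * (n + 1)⌉₊ : ℝ) / (n + 1) ≤ r + 1 / (n + 1) := by
  rw [div_le_iff₀ (by positivity), add_mul, div_mul_cancel₀ _ (by positivity)]
  exact (Nat.ceil_lt_add_one (by positivity)).le

lemma ceil_div_le_add_one (n : ℕ) {r : ℝ} (hr : 0 ≤ r) :
    (⌈r * (n + 1)⌉₊ : ℝ) / (n + 1) ≤ r + 1 := by
  refine (ceil_div_le n hr).trans ?_
  gcongr
  rw [div_le_one (by positivity)]
  linarith [(Nat.cast_nonneg n : (0 : ℝ) ≤ n)]

lemma tendsto_ceil_div {r : ℝ} (hr : 0 ≤ r) :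
    Tendsto (fun n : ℕ ↦ (⌈r * (n + 1)⌉₊ : ℝ) / (n + 1)) atTop (𝓝[≥] r) := by
  refine tendsto_nhdsWithin_iff.2 ⟨?_, .of_forall fun n ↦ le_ceil_div n r⟩
  refine tendsto_of_tendsto_of_tendsto_of_le_of_le tendsto_const_nhds ?_
    (fun n ↦ le_ceil_div n r) (fun n ↦ ceil_div_le n hr)
  simpa using tendsto_one_div_add_atTop_nhds_zero_nat (𝕜 := ℝ) |>.const_add r

/-- On the grid cell `(i / (n + 1), (i + 1) / (n + 1)]` rounding up gives the right endpoint. -/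
lemma ceil_eq_of_mem_cell {n i : ℕ} {r : ℝ}
    (hr : r ∈ Set.Ioc ((i : ℝ) / (n + 1)) (((i + 1 : ℕ) : ℝ) / (n + 1))) :
    ⌈r * (n + 1)⌉₊ = i + 1 := by
  have hn : (0 : ℝ) < n + 1 := by positivity
  have h1 := (div_lt_iff₀ hn).1 hr.1
  have h2 := (le_div_iff₀ hn).1 hr.2
  rw [Nat.ceil_eq_iff (by omega)]
  exact ⟨by simpa using h1, h2⟩

end GridPoints

section Pathwise

variable {x v : ℝ → ℝ} {lam : ℝ}

lemma continuousWithinAt_of_integral_eq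
    (hvc : ∀ t, 0 ≤ t → ContinuousWithinAt v (Set.Ici t) t)
    (hx : ∀ t, 0 ≤ t → IntervalIntegrable x volume 0 t ∧
      x t = x 0 - lam * (∫ s in (0 : ℝ)..t, x s) + (v t - v 0)) {t : ℝ} (ht : 0 ≤ t) :
    ContinuousWithinAt x (Set.Ici t) t := by
  have hA := intervalIntegral.continuousOn_primitive_interval' (hx (t + 1) (by linarith)).1
    (Set.left_mem_uIcc)
  rw [Set.uIcc_of_le (by linarith)] at hA
  have hA' : ContinuousWithinAt (fun b ↦ ∫ s in (0 : ℝ)..b, x s) (Set.Ici t) t := by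
    refine (hA t ⟨ht, by linarith⟩).mono_of_mem_nhdsWithin ?_
    exact mem_of_superset (Icc_mem_nhdsGE (by linarith : t < t + 1))
      (Set.Icc_subset_Icc_left ht)
  have h : ContinuousWithinAt
      (fun t ↦ x 0 - lam * (∫ s in (0 : ℝ)..t, x s) + (v t - v 0)) (Set.Ici t) t :=
    (continuousWithinAt_const.sub (continuousWithinAt_const.mul hA')).add
      ((hvc t ht).sub continuousWithinAt_const)
  exact h.congr (fun s hs ↦ (hx s (ht.trans hs)).2) (hx t ht).2

lemma exists_abs_le_of_integral_eq (hv : MonotoneOn v (Set.Ici 0))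
    (hx : ∀ t, 0 ≤ t → IntervalIntegrable x volume 0 t ∧
      x t = x 0 - lam * (∫ s in (0 : ℝ)..t, x s) + (v t - v 0)) {T : ℝ} (hT : 0 ≤ T) :
    ∃ B, 0 ≤ B ∧ ∀ s ∈ Set.Icc 0 T, |x s| ≤ B := by
  have hA := intervalIntegral.continuousOn_primitive_interval' (hx T hT).1 (Set.left_mem_uIcc)
  rw [Set.uIcc_of_le hT] at hA
  obtain ⟨C, hC⟩ := isCompact_Icc.exists_bound_of_continuousOn hA
  have hC0 : 0 ≤ C := (norm_nonneg _).trans (hC 0 ⟨le_rfl, hT⟩)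
  have hv0 : ∀ s ∈ Set.Icc 0 T, 0 ≤ v s - v 0 ∧ v s - v 0 ≤ v T - v 0 := fun s hs ↦
    ⟨sub_nonneg.2 (hv Set.self_mem_Ici hs.1 hs.1), sub_le_sub_right (hv hs.1 hT hs.2) _⟩
  refine ⟨|x 0| + |lam| * C + (v T - v 0), ?_, fun s hs ↦ ?_⟩
  · have := (hv0 T ⟨hT, le_rfl⟩).1
    positivity
  · rw [(hx s hs.1).2]
    have h1 := hC s hs
    rw [Real.norm_eq_abs] at h1
    refine (abs_add_le _ _).trans (add_le_add ((abs_sub _ _).trans (add_le_add le_rfl ?_)) ?_)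
    · rw [abs_mul]
      gcongr
    · rw [abs_of_nonneg (hv0 s hs).1]
      exact (hv0 s hs).2

/-- Pathwise solution of `dx = -lam x dt + dv` as a limit of Riemann–Stieltjes sums: the sums for
`∫₀ᵗ e^{-lam (t - s)} dv(s)` over the grid of mesh `1 / (n + 1)` converge to `x t - e^{-lam t} x 0`.

After summation by parts, the error is, up to the factor `e^{-lam t}`, the integral of
`lam (e^{lam (c - 1/(n+1))} x r - e^{lam r} x c)`, `c` being the first grid point above `r`; this
integrand is bounded and, by right-continuity of `x`, tends to `0`. -/
lemma tendsto_riemann_sum (hv : MonotoneOn v (Set.Ici 0))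
    (hvc : ∀ t, 0 ≤ t → ContinuousWithinAt v (Set.Ici t) t)
    (hx : ∀ t, 0 ≤ t → IntervalIntegrable x volume 0 t ∧
      x t = x 0 - lam * (∫ s in (0 : ℝ)..t, x s) + (v t - v 0))
    (hlam : 0 ≤ lam) {t : ℝ} (ht : 0 ≤ t) :
    Tendsto (fun n : ℕ ↦ ∑ i ∈ Finset.range ⌈t * (n + 1)⌉₊,
      Real.exp (-(lam * (t - i / (n + 1)))) *
        (v (((i + 1 : ℕ) : ℝ) / (n + 1)) - v ((i : ℝ) / (n + 1)))) atTop
      (𝓝 (x t - Real.exp (-(lam * t)) * x 0)) := by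
  have hxr : ∀ s, 0 ≤ s → ContinuousWithinAt x (Set.Ici s) s := fun s hs ↦
    continuousWithinAt_of_integral_eq hvc hx hs
  have hxI : ∀ a b, 0 ≤ a → 0 ≤ b → IntervalIntegrable x volume a b := fun a b ha hb ↦
    (hx a ha).1.symm.trans (hx b hb).1
  obtain ⟨B, hB0, hB⟩ := exists_abs_le_of_integral_eq hv hx (by linarith : 0 ≤ t + 2)
  set c : ℕ → ℝ → ℝ := fun n r ↦ (⌈r * (n + 1)⌉₊ : ℝ) / (n + 1) with hc
  set H : ℕ → ℝ → ℝ := fun n r ↦ lam * (Real.exp (lam * (c n r - 1 / (n + 1))) * x r -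
    Real.exp (lam * r) * x (c n r)) with hH
  have hpos : ∀ n : ℕ, (0 : ℝ) < n + 1 := fun n ↦ by positivity
  -- `x` at rounded times factors through `ℕ`, hence is measurable.
  have hHm : ∀ n T, 0 ≤ T → AEStronglyMeasurable (H n) (volume.restrict (Set.Ioc 0 T)) := by
    intro n T hT
    have hceil : Measurable fun r : ℝ ↦ ⌈r * (n + 1)⌉₊ :=
      Nat.measurable_ceil.comp (measurable_id.mul_const _)
    have h1 : Measurable (c n) :=
      (measurable_of_countable (fun k : ℕ ↦ (k : ℝ) / (n + 1))).comp hceil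
    have h2 : Measurable fun r ↦ x (c n r) :=
      (measurable_of_countable (fun k : ℕ ↦ x ((k : ℝ) / (n + 1)))).comp hceil
    have h3 : AEStronglyMeasurable x (volume.restrict (Set.Ioc 0 T)) :=
      (hx T hT).1.1.aestronglyMeasurable
    have h4 : Measurable fun r ↦ Real.exp (lam * (c n r - 1 / (n + 1))) := by fun_prop
    have h5 : Measurable fun r : ℝ ↦ Real.exp (lam * r) := by fun_prop
    exact ((h4.aestronglyMeasurable.mul h3).sub (h5.mul h2).aestronglyMeasurable).const_mul lam
  have hHb : ∀ n, ∀ r ∈ Set.Ioc 0 (t + 1), ‖H n r‖ ≤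
      lam * (Real.exp (lam * (t + 2)) * B + Real.exp (lam * (t + 2)) * B) := by
    intro n r hr
    have hc1 : r ≤ c n r := le_ceil_div n r
    have hc2 : c n r ≤ r + 1 := ceil_div_le_add_one n hr.1.le
    have hd : 0 < 1 / ((n : ℝ) + 1) := by positivity
    rw [hH, norm_mul, Real.norm_of_nonneg hlam]
    refine mul_le_mul_of_nonneg_left ((norm_sub_le _ _).trans ?_) hlam
    rw [norm_mul, norm_mul, Real.norm_of_nonneg (Real.exp_pos _).le,
      Real.norm_of_nonneg (Real.exp_pos _).le, Real.norm_eq_abs, Real.norm_eq_abs]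
    gcongr
    · linarith [hr.2]
    · exact hB r ⟨hr.1.le, by linarith [hr.2]⟩
    · linarith [hr.2]
    · exact hB _ ⟨by linarith [hr.1], by linarith [hr.2]⟩
  have hHI : ∀ n, IntegrableOn (H n) (Set.Ioc 0 (t + 1)) := fun n ↦
    IntegrableOn.of_bound (by simp) (hHm n _ (by linarith)) _
      ((ae_restrict_iff' measurableSet_Ioc).2 (.of_forall (hHb n)))
  have hHlim : Tendsto (fun n ↦ ∫ r in Set.Ioc 0 (t + 1), ‖H n r‖) atTop (𝓝 0) := by
    suffices h : Tendsto (fun n ↦ ∫ r in Set.Ioc 0 (t + 1), ‖H n r‖) atTop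
        (𝓝 (∫ _ in Set.Ioc 0 (t + 1), (0 : ℝ))) by simpa using h
    refine tendsto_integral_of_dominated_convergence
      (fun _ ↦ lam * (Real.exp (lam * (t + 2)) * B + Real.exp (lam * (t + 2)) * B))
      (fun n ↦ (hHm n _ (by linarith)).norm) (integrable_const _)
      (fun n ↦ (ae_restrict_iff' measurableSet_Ioc).2 (.of_forall fun r hr ↦ by
        rw [norm_norm]
        exact hHb n r hr))
      ((ae_restrict_iff' measurableSet_Ioc).2 (.of_forall fun r hr ↦ ?_))
    have hcl : Tendsto (fun n ↦ c n r) atTop (𝓝[≥] r) := tendsto_ceil_div hr.1.le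
    have hxl : Tendsto (fun n ↦ x (c n r)) atTop (𝓝 (x r)) := (hxr r hr.1.le).tendsto.comp hcl
    have hel : Tendsto (fun n : ℕ ↦ Real.exp (lam * (c n r - 1 / (n + 1)))) atTop
        (𝓝 (Real.exp (lam * (r - 0)))) :=
      (Real.continuous_exp.tendsto _).comp
        (((tendsto_nhdsWithin_iff.1 hcl).1.sub tendsto_one_div_add_atTop_nhds_zero_nat).const_mul
          lam)
    have := ((((hel.mul_const (x r)).sub (hxl.const_mul (Real.exp (lam * r)))).const_mul lam)).norm
    simpa [hH] using this
  have hstep : ∀ n i : ℕ, Real.exp (lam * (i / (n + 1))) *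
        (v (((i + 1 : ℕ) : ℝ) / (n + 1)) - v ((i : ℝ) / (n + 1))) =
      (Real.exp (lam * (((i + 1 : ℕ) : ℝ) / (n + 1))) * x (((i + 1 : ℕ) : ℝ) / (n + 1)) -
        Real.exp (lam * ((i : ℝ) / (n + 1))) * x ((i : ℝ) / (n + 1))) +
      ∫ r in ((i : ℝ) / (n + 1))..(((i + 1 : ℕ) : ℝ) / (n + 1)), H n r := by
    intro n i
    set p : ℝ := (i : ℝ) / (n + 1) with hp
    set q : ℝ := ((i + 1 : ℕ) : ℝ) / (n + 1) with hq
    have hp0 : 0 ≤ p := by positivity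
    have hq0 : 0 ≤ q := by positivity
    have hpq : p ≤ q := by
      rw [hp, hq]
      gcongr
      simp
    have hqp : q - 1 / (n + 1) = p := by
      rw [hp, hq]
      push_cast
      ring
    have hint : ∫ r in p..q, H n r =
        ∫ r in p..q, (lam * Real.exp (lam * p) * x r - x q * (lam * Real.exp (lam * r))) := by
      refine intervalIntegral.integral_congr_ae (.of_forall fun r hr ↦ ?_)
      rw [Set.uIoc_of_le hpq] at hr
      have hcq : c n r = q := by
        rw [hc, hq]
        dsimp only
        rw [ceil_eq_of_mem_cell hr]
      simp only [hH, hcq, hqp]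
      ring
    have hexp : ∫ r in p..q, lam * Real.exp (lam * r) =
        Real.exp (lam * q) - Real.exp (lam * p) := by
      refine intervalIntegral.integral_eq_sub_of_hasDerivAt (f := fun r ↦ Real.exp (lam * r))
        (fun r _ ↦ ?_) (Continuous.intervalIntegrable (by fun_prop) _ _)
      have := ((hasDerivAt_id r).const_mul lam).exp
      simpa [mul_comm] using this
    have hvq : v q - v p = x q - x p + lam * ∫ r in p..q, x r := by
      have h1 := (hx q hq0).2
      have h2 := (hx p hp0).2
      have h3 := intervalIntegral.integral_interval_sub_left (hx q hq0).1 (hx p hp0).1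
      rw [← h3, mul_sub]
      linarith
    rw [hint, intervalIntegral.integral_sub ((hxI p q hp0 hq0).const_mul _)
      ((Continuous.intervalIntegrable (by fun_prop) _ _).const_mul _),
      intervalIntegral.integral_const_mul, intervalIntegral.integral_const_mul, hexp, hvq]
    ring
  have hsum : ∀ n : ℕ, ∑ i ∈ Finset.range ⌈t * (n + 1)⌉₊,
      Real.exp (-(lam * (t - i / (n + 1)))) *
        (v (((i + 1 : ℕ) : ℝ) / (n + 1)) - v ((i : ℝ) / (n + 1))) =
      Real.exp (-(lam * t)) *
        (Real.exp (lam * c n t) * x (c n t) - x 0 + ∫ r in (0 : ℝ)..(c n t), H n r) := by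
    intro n
    have hle : ∀ i ∈ Finset.range ⌈t * (n + 1)⌉₊, ((i + 1 : ℕ) : ℝ) / (n + 1) ≤ t + 1 := by
      intro i hi
      refine le_trans ?_ (ceil_div_le_add_one n ht)
      gcongr
      exact_mod_cast Finset.mem_range.1 hi
    have hadj := intervalIntegral.sum_integral_adjacent_intervals (f := H n) (μ := volume)
      (a := fun i : ℕ ↦ (i : ℝ) / (n + 1)) (n := ⌈t * (n + 1)⌉₊) (fun i hi ↦ by
        rw [intervalIntegrable_iff_integrableOn_Ioc_of_le (by gcongr; simp)]
        exact (hHI n).mono_set (Set.Ioc_subset_Ioc (by positivity)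
          (hle i (Finset.mem_range.2 hi))))
    have htel := Finset.sum_range_sub
      (fun i : ℕ ↦ Real.exp (lam * ((i : ℝ) / (n + 1))) * x ((i : ℝ) / (n + 1))) ⌈t * (n + 1)⌉₊
    have e : ∀ i ∈ Finset.range ⌈t * (n + 1)⌉₊, Real.exp (-(lam * (t - i / (n + 1)))) *
        (v (((i + 1 : ℕ) : ℝ) / (n + 1)) - v ((i : ℝ) / (n + 1))) =
        Real.exp (-(lam * t)) * ((Real.exp (lam * (((i + 1 : ℕ) : ℝ) / (n + 1))) *
          x (((i + 1 : ℕ) : ℝ) / (n + 1)) -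
          Real.exp (lam * ((i : ℝ) / (n + 1))) * x ((i : ℝ) / (n + 1))) +
        ∫ r in ((i : ℝ) / (n + 1))..(((i + 1 : ℕ) : ℝ) / (n + 1)), H n r) := by
      intro i hi
      rw [← hstep n i, ← mul_assoc, ← Real.exp_add]
      ring_nf
    rw [Finset.sum_congr rfl e, ← Finset.mul_sum, Finset.sum_add_distrib, htel, hadj]
    simp [hc]
  simp_rw [hsum]
  have hcl : Tendsto (fun n ↦ c n t) atTop (𝓝[≥] t) := tendsto_ceil_div ht
  have hxl : Tendsto (fun n ↦ x (c n t)) atTop (𝓝 (x t)) := (hxr t ht).tendsto.comp hcl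
  have hel : Tendsto (fun n : ℕ ↦ Real.exp (lam * c n t)) atTop (𝓝 (Real.exp (lam * t))) :=
    (Real.continuous_exp.tendsto _).comp ((tendsto_nhdsWithin_iff.1 hcl).1.const_mul lam)
  have hIl : Tendsto (fun n ↦ ∫ r in (0 : ℝ)..(c n t), H n r) atTop (𝓝 0) := by
    refine squeeze_zero_norm (fun n ↦ ?_) hHlim
    have hc0 : 0 ≤ c n t := ht.trans (le_ceil_div n t)
    rw [intervalIntegral.integral_of_le hc0]
    refine (norm_integral_le_integral_norm _).trans ?_
    exact setIntegral_mono_set (hHI n).norm (.of_forall fun _ ↦ norm_nonneg _)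
      (Set.Ioc_subset_Ioc_right (ceil_div_le_add_one n ht)).eventuallyLE
  have := (((hel.mul hxl).sub_const (x 0)).add hIl).const_mul (Real.exp (-(lam * t)))
  convert this using 2
  rw [add_zero, mul_sub, ← mul_assoc, ← Real.exp_add]
  simp

end Pathwise

/-! ### Characteristic functions of stationary solutions -/

section RiemannSums

variable {Ω : Type*} [MeasurableSpace Ω] {P : Measure Ω} {lam : ℝ≥0} {Z X : ℝ≥0 → Ω → ℝ}
  {g : ℝ → ℂ}

/-- The weight `e^{-lam (t - i / (n + 1))}` of the `i`-th increment in the Riemann sum for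
`∫₀ᵗ e^{-lam (t - s)} dZ(lam s)`; it vanishes beyond the last grid cell that meets `[0, t)`. -/
noncomputable def ouWeight (lam t : ℝ≥0) (n i : ℕ) : ℝ :=
  if i < ⌈(t : ℝ) * (n + 1)⌉₊ then Real.exp (-(lam * ((t : ℝ) - i / (n + 1)))) else 0

/-- The increment of `s ↦ Z (lam s)` over the `i`-th cell of the grid of mesh `1 / (n + 1)`. -/
noncomputable def gridIncrement (lam : ℝ≥0) (Z : ℝ≥0 → Ω → ℝ) (n i : ℕ) (ω : Ω) : ℝ :=
  Z (((i + 1 : ℕ) : ℝ≥0) * (lam / (n + 1))) ω - Z ((i : ℝ≥0) * (lam / (n + 1))) ω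

lemma toNNReal_grid (lam : ℝ≥0) (n i : ℕ) :
    lam * ((i : ℝ) / (n + 1)).toNNReal = (i : ℝ≥0) * (lam / (n + 1)) := by
  have h : ((i : ℝ) / (n + 1)).toNNReal = (i : ℝ≥0) / (n + 1) := by
    rw [Real.toNNReal_of_nonneg (by positivity)]
    ext
    push_cast
    rfl
  rw [h]
  ring

/-- The Riemann sums for the stochastic integral in the explicit solution converge pathwise. -/
lemma IsStationaryOU.ae_tendsto_riemann_sum (hX : IsStationaryOU lam Z X P)
    (hZ : IsSubordinator g Z P) :
    ∀ᵐ ω ∂P, ∀ t : ℝ≥0, Tendsto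
      (fun n : ℕ ↦ ∑ i ∈ Finset.range ⌈(t : ℝ) * (n + 1)⌉₊,
        ouWeight lam t n i * gridIncrement lam Z n i ω) atTop
      (𝓝 (X t ω - Real.exp (-(lam * t)) * X 0 ω)) := by
  filter_upwards [hX.sde, hZ.paths] with ω hω hp t
  have hv : MonotoneOn (fun s : ℝ ↦ Z (lam * s.toNNReal) ω) (Set.Ici 0) := by
    intro a _ b _ hab
    exact hp.1 (by gcongr)
  have hvc : ∀ s : ℝ, 0 ≤ s →
      ContinuousWithinAt (fun s : ℝ ↦ Z (lam * s.toNNReal) ω) (Set.Ici s) s := by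
    intro s _
    refine ContinuousWithinAt.comp (f := fun s : ℝ ↦ lam * s.toNNReal)
      (hp.2 (lam * s.toNNReal)) (by fun_prop) fun r hr ↦ ?_
    exact mul_le_mul_right (Real.toNNReal_mono hr) lam
  have h := tendsto_riemann_sum (x := fun s ↦ X s.toNNReal ω)
    (v := fun s ↦ Z (lam * s.toNNReal) ω) (lam := lam) (t := (t : ℝ)) hv hvc (fun s hs ↦ ?_)
    lam.coe_nonneg t.coe_nonneg
  · simp only [Real.toNNReal_coe, Real.toNNReal_zero, toNNReal_grid] at h
    refine h.congr fun n ↦ Finset.sum_congr rfl fun i hi ↦ ?_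
    rw [ouWeight, if_pos (Finset.mem_range.1 hi), gridIncrement]
  · have h1 := hω s.toNNReal
    simp only [Real.coe_toNNReal s hs] at h1
    simpa using h1

/-- The number of grid cells that meet `[0, t)` for some `t ∈ I`. -/
noncomputable def gridSize (I : Finset ℝ≥0) (n : ℕ) : ℕ := I.sup fun t ↦ ⌈(t : ℝ) * (n + 1)⌉₊

lemma sum_ouWeight_mul_eq (I : Finset ℝ≥0) (u : ℝ≥0 → ℝ) (n : ℕ) (d : ℕ → ℝ) :
    ∑ t ∈ I, u t * ∑ i ∈ Finset.range ⌈(t : ℝ) * (n + 1)⌉₊,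
      ouWeight lam t n i * d i =
    ∑ i ∈ Finset.range (gridSize I n),
      (∑ t ∈ I, u t * ouWeight lam t n i) * d i := by
  simp_rw [Finset.sum_mul]
  rw [Finset.sum_comm]
  refine Finset.sum_congr rfl fun t ht ↦ ?_
  rw [Finset.mul_sum]
  refine (Finset.sum_congr rfl fun i _ ↦ (mul_assoc _ _ _).symm).trans
    (Finset.sum_subset (Finset.range_mono (Finset.le_sup (f := fun t : ℝ≥0 ↦
      ⌈(t : ℝ) * (n + 1)⌉₊) ht)) fun i _ hi ↦ ?_)
  rw [ouWeight, if_neg (by simpa using hi)]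
  simp

/-- For a solution driven by a subordinator with exponent `g`, the joint characteristic function of
`X 0` and of the noise terms `X t - e^{-lam t} X 0` is the limit of an explicit expression in which
`g` enters linearly, in the exponent. -/
lemma IsStationaryOU.tendsto_charFun [IsProbabilityMeasure P] (hX : IsStationaryOU lam Z X P)
    (hZ : IsSubordinator g Z P) (I : Finset ℝ≥0) (u : ℝ≥0 → ℝ) (a : ℝ) :
    Tendsto (fun n : ℕ ↦ (∫ ω, cexp ((a * X 0 ω : ℝ) * Complex.I) ∂P) *
        cexp ((lam / (n + 1) : ℝ≥0) * ∑ i ∈ Finset.range (gridSize I n),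
          g (∑ t ∈ I, u t * ouWeight lam t n i))) atTop
      (𝓝 (∫ ω, cexp ((a * X 0 ω + ∑ t ∈ I, u t * (X t ω - Real.exp (-(lam * t)) * X 0 ω) : ℝ) *
        Complex.I) ∂P)) := by
  set ψ : ℕ → (ℝ≥0 → ℝ) → ℝ := fun n f ↦ ∑ i ∈ Finset.range (gridSize I n),
    (∑ t ∈ I, u t * ouWeight lam t n i) * (f (((i + 1 : ℕ) : ℝ≥0) * (lam / (n + 1))) -
      f ((i : ℝ≥0) * (lam / (n + 1)))) with hψ
  have hψm : ∀ n, Measurable (ψ n) := fun n ↦ Finset.measurable_fun_sum _ fun i _ ↦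
    (Measurable.fun_sub (measurable_pi_apply (((i + 1 : ℕ) : ℝ≥0) * (lam / (n + 1))))
      (measurable_pi_apply ((i : ℝ≥0) * (lam / (n + 1))))).const_mul _
  have hZm : Measurable fun ω t ↦ Z t ω := measurable_pi_lambda _ hZ.measurable
  have hSm : ∀ n, Measurable fun ω ↦ ψ n (fun t ↦ Z t ω) := fun n ↦ (hψm n).comp hZm
  have he : ∀ b : ℝ, Measurable fun y : ℝ ↦ cexp ((b * y : ℝ) * Complex.I) := fun b ↦ by fun_prop
  have hfac : ∀ n, ∫ ω, cexp ((a * X 0 ω + ψ n (fun t ↦ Z t ω) : ℝ) * Complex.I) ∂P =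
      (∫ ω, cexp ((a * X 0 ω : ℝ) * Complex.I) ∂P) *
        cexp ((lam / (n + 1) : ℝ≥0) * ∑ i ∈ Finset.range (gridSize I n),
          g (∑ t ∈ I, u t * ouWeight lam t n i)) := by
    intro n
    have hind : IndepFun (X 0) (fun ω ↦ ψ n (fun t ↦ Z t ω)) P :=
      hX.indep_initial.comp measurable_id (hψm n)
    rw [← hZ.charFun_grid]
    have := hind.integral_fun_comp_mul_comp (f := fun y : ℝ ↦ cexp ((a * y : ℝ) * Complex.I))
      (g := fun y : ℝ ↦ cexp ((1 * y : ℝ) * Complex.I)) (hX.measurable 0).aemeasurable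
      (hSm n).aemeasurable (he a).aestronglyMeasurable (he 1).aestronglyMeasurable
    simp only [one_mul] at this
    rw [← this]
    refine integral_congr_ae (.of_forall fun ω ↦ ?_)
    dsimp only
    rw [← Complex.exp_add, ← add_mul, ← ofReal_add]
  simp_rw [← hfac]
  refine tendsto_integral_of_dominated_convergence (fun _ ↦ 1) (fun n ↦ ?_) (integrable_const _)
    (fun n ↦ .of_forall fun ω ↦ (Complex.norm_exp_ofReal_mul_I _).le) ?_
  · have := ((hX.measurable 0).const_mul a).add (hSm n)
    exact (Complex.measurable_exp.comp
      ((Complex.measurable_ofReal.comp this).mul_const _)).aestronglyMeasurable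
  · filter_upwards [hX.ae_tendsto_riemann_sum hZ] with ω hω
    have h1 : Tendsto (fun n ↦ ψ n (fun t ↦ Z t ω)) atTop
        (𝓝 (∑ t ∈ I, u t * (X t ω - Real.exp (-(lam * t)) * X 0 ω))) := by
      have := tendsto_finsetSum I fun t _ ↦ (hω t).const_mul (u t)
      refine this.congr fun n ↦ ?_
      rw [sum_ouWeight_mul_eq]
      rfl
    exact (Complex.continuous_exp.tendsto _).comp
      (((Complex.continuous_ofReal.tendsto _).comp (h1.const_add _)).mul_const _)

/-- The noise terms `X t - e^{-lam t} X 0` are independent of `X 0`, at the level of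
characteristic functions. -/
lemma IsStationaryOU.charFun_eq_mul [IsProbabilityMeasure P] (hX : IsStationaryOU lam Z X P)
    (hZ : IsSubordinator g Z P) (I : Finset ℝ≥0) (u : ℝ≥0 → ℝ) (a : ℝ) :
    ∫ ω, cexp ((a * X 0 ω + ∑ t ∈ I, u t * (X t ω - Real.exp (-(lam * t)) * X 0 ω) : ℝ) *
        Complex.I) ∂P =
      (∫ ω, cexp ((a * X 0 ω : ℝ) * Complex.I) ∂P) *
      ∫ ω, cexp ((∑ t ∈ I, u t * (X t ω - Real.exp (-(lam * t)) * X 0 ω) : ℝ) *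
        Complex.I) ∂P := by
  have h0 := (hX.tendsto_charFun hZ I u 0).const_mul
    (∫ ω, cexp ((a * X 0 ω : ℝ) * Complex.I) ∂P)
  simp only [zero_mul, ofReal_zero, Complex.exp_zero, integral_const, probReal_univ, one_smul,
    one_mul, zero_add] at h0
  exact tendsto_nhds_unique (hX.tendsto_charFun hZ I u a) h0

lemma IsStationaryOU.charFun_sum_eq_mul [IsProbabilityMeasure P] (hX : IsStationaryOU lam Z X P)
    (hZ : IsSubordinator g Z P) (I : Finset ℝ≥0) (u : ℝ≥0 → ℝ) :
    ∫ ω, cexp ((∑ t ∈ I, u t * X t ω : ℝ) * Complex.I) ∂P =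
      (∫ ω, cexp (((∑ t ∈ I, u t * Real.exp (-(lam * t))) * X 0 ω : ℝ) * Complex.I) ∂P) *
      ∫ ω, cexp ((∑ t ∈ I, u t * (X t ω - Real.exp (-(lam * t)) * X 0 ω) : ℝ) *
        Complex.I) ∂P := by
  rw [← hX.charFun_eq_mul hZ]
  refine integral_congr_ae (.of_forall fun ω ↦ ?_)
  dsimp only
  congr 3
  rw [Finset.sum_mul, ← Finset.sum_add_distrib]
  exact Finset.sum_congr rfl fun t _ ↦ by ring

/-- Stationarity and contraction determine the law of `X 0` from the noise. -/
lemma IsStationaryOU.tendsto_charFun_noise [IsProbabilityMeasure P] (hlam : 0 < lam)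
    (hX : IsStationaryOU lam Z X P) (hZ : IsSubordinator g Z P) (b : ℝ) :
    Tendsto (fun N : ℕ ↦ ∫ ω, cexp ((b * (X N ω - Real.exp (-(lam * (N : ℝ))) * X 0 ω) : ℝ) *
        Complex.I) ∂P) atTop
      (𝓝 (∫ ω, cexp ((b * X 0 ω : ℝ) * Complex.I) ∂P)) := by
  set φ : ℝ → ℂ := fun a ↦ ∫ ω, cexp ((a * X 0 ω : ℝ) * Complex.I) ∂P with hφ
  have hdec : Tendsto (fun N : ℕ ↦ b * Real.exp (-(lam * (N : ℝ)))) atTop (𝓝 0) := by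
    rw [← mul_zero b]
    refine (Real.tendsto_exp_neg_atTop_nhds_zero.comp ?_).const_mul b
    exact tendsto_natCast_atTop_atTop.const_mul_atTop (by exact_mod_cast hlam)
  have hφ1 : Tendsto (fun N : ℕ ↦ φ (b * Real.exp (-(lam * (N : ℝ))))) atTop (𝓝 1) := by
    have h1 : (1 : ℂ) = ∫ _, (1 : ℂ) ∂P := by simp
    rw [h1]
    refine tendsto_integral_of_dominated_convergence (fun _ ↦ 1) (fun n ↦ ?_)
      (integrable_const _) (fun n ↦ .of_forall fun ω ↦ (Complex.norm_exp_ofReal_mul_I _).le)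
      (.of_forall fun ω ↦ ?_)
    · exact (Complex.measurable_exp.comp ((Complex.measurable_ofReal.comp
        ((hX.measurable 0).const_mul _)).mul_const _)).aestronglyMeasurable
    · have := (Complex.continuous_exp.tendsto _).comp
        (((Complex.continuous_ofReal.tendsto _).comp (hdec.mul_const (X 0 ω))).mul_const Complex.I)
      simpa [Function.comp_def] using this
  have hstat : ∀ N : ℕ, ∫ ω, cexp ((b * X N ω : ℝ) * Complex.I) ∂P = φ b := by
    intro N
    have h := hX.stationary N {0}
    have hm : Measurable fun y : ({0} : Finset ℝ≥0) → ℝ ↦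
        cexp ((b * y ⟨0, by simp⟩ : ℝ) * Complex.I) := by fun_prop
    have := (h.comp hm).integral_eq
    simpa [hφ, Function.comp_def] using this
  have hmul : ∀ N : ℕ, φ b = φ (b * Real.exp (-(lam * (N : ℝ)))) *
      ∫ ω, cexp ((b * (X N ω - Real.exp (-(lam * (N : ℝ))) * X 0 ω) : ℝ) * Complex.I) ∂P := by
    intro N
    have h := hX.charFun_sum_eq_mul hZ {(N : ℝ≥0)} fun _ ↦ b
    simp only [Finset.sum_singleton, NNReal.coe_natCast, hstat] at h
    exact h
  have hne : ∀ᶠ N : ℕ in atTop, φ (b * Real.exp (-(lam * (N : ℝ)))) ≠ 0 :=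
    hφ1.eventually_ne one_ne_zero
  have hdiv := hφ1.inv₀ one_ne_zero |>.const_mul (φ b)
  rw [inv_one, mul_one] at hdiv
  refine hdiv.congr' ?_
  filter_upwards [hne] with N hN
  rw [hmul N, mul_comm, ← mul_assoc, inv_mul_cancel₀ hN, one_mul]

end RiemannSums

/-! ### Superposition of independent solutions -/

section Superposition

lemma exists_forall_restrict_eq_sum (I : Finset ℝ≥0) (L : StrongDual ℝ (I → ℝ)) :
    ∃ u : ℝ≥0 → ℝ, ∀ f : ℝ≥0 → ℝ, L (I.restrict f) = ∑ t ∈ I, u t * f t := by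
  classical
  refine ⟨fun t ↦ if h : t ∈ I then L (Pi.single ⟨t, h⟩ 1) else 0, fun f ↦ ?_⟩
  have h1 : I.restrict f = ∑ t : I, f t • (Pi.single t (1 : ℝ) : I → ℝ) := by
    ext s
    simp [Finset.sum_apply, Pi.single_apply]
  rw [h1, map_sum, ← Finset.sum_coe_sort I]
  refine Finset.sum_congr rfl fun t _ ↦ ?_
  rw [map_smul]
  simp [mul_comm]

lemma charFunDual_map_restrict {Ω : Type*} [MeasurableSpace Ω] {P : Measure Ω}
    {W : ℝ≥0 → Ω → ℝ} {I : Finset ℝ≥0} (hW : Measurable fun ω ↦ I.restrict (W · ω))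
    {L : StrongDual ℝ (I → ℝ)} {u : ℝ≥0 → ℝ}
    (hL : ∀ f : ℝ≥0 → ℝ, L (I.restrict f) = ∑ t ∈ I, u t * f t) :
    charFunDual (P.map fun ω ↦ I.restrict (W · ω)) L =
      ∫ ω, cexp ((∑ t ∈ I, u t * W t ω : ℝ) * Complex.I) ∂P := by
  rw [charFunDual_apply, integral_map hW.aemeasurable
    (Measurable.aestronglyMeasurable (by fun_prop))]
  simp only [hL]

variable {Ω Ω' : Type*} [MeasurableSpace Ω] [MeasurableSpace Ω'] {P : Measure Ω} {Q : Measure Ω'}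
  [IsProbabilityMeasure P] [IsProbabilityMeasure Q] {lam : ℝ≥0} {Z X : ℝ≥0 → Ω → ℝ}
  {ι : Type*} [Fintype ι] {ZD D : ι → ℝ≥0 → Ω' → ℝ} {g : ι → ℝ → ℂ}

/-- Adding the exponents of the drivers multiplies the characteristic functions of the noise. -/
lemma IsStationaryOU.charFun_noise_eq_prod (hX : IsStationaryOU lam Z X P)
    (hZ : IsSubordinator (fun u ↦ ∑ j, g j u) Z P)
    (hD : ∀ j, IsStationaryOU lam (ZD j) (D j) Q) (hZD : ∀ j, IsSubordinator (g j) (ZD j) Q)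
    (I : Finset ℝ≥0) (u : ℝ≥0 → ℝ) :
    ∫ ω, cexp ((∑ t ∈ I, u t * (X t ω - Real.exp (-(lam * t)) * X 0 ω) : ℝ) * Complex.I) ∂P =
      ∏ j, ∫ ω, cexp ((∑ t ∈ I, u t * (D j t ω - Real.exp (-(lam * t)) * D j 0 ω) : ℝ) *
        Complex.I) ∂Q := by
  have hX0 := hX.tendsto_charFun hZ I u 0
  have hD0 := tendsto_finsetProd Finset.univ fun j _ ↦ (hD j).tendsto_charFun (hZD j) I u 0
  simp only [zero_mul, ofReal_zero, Complex.exp_zero, integral_const, probReal_univ, one_smul,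
    one_mul, zero_add] at hX0 hD0
  refine tendsto_nhds_unique hX0 (hD0.congr fun n ↦ ?_)
  rw [← Complex.exp_sum, ← Finset.mul_sum, Finset.sum_comm]

/-- A stationary solution whose driver has exponent `∑ j, g j` has the finite-dimensional
distributions of the sum of independent stationary solutions whose drivers have exponents `g j`. -/
lemma IsStationaryOU.sameFDD_sum (hlam : 0 < lam) (hX : IsStationaryOU lam Z X P)
    (hZ : IsSubordinator (fun u ↦ ∑ j, g j u) Z P)
    (hD : ∀ j, IsStationaryOU lam (ZD j) (D j) Q) (hZD : ∀ j, IsSubordinator (g j) (ZD j) Q)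
    (hind : iIndepFun (fun (j : ι) (ω : Ω') (t : ℝ≥0) ↦ D j t ω) Q) :
    SameFDD X P (fun t ω ↦ ∑ j, D j t ω) Q := by
  have h0 : ∀ b : ℝ, ∫ ω, cexp ((b * X 0 ω : ℝ) * Complex.I) ∂P =
      ∏ j, ∫ ω, cexp ((b * D j 0 ω : ℝ) * Complex.I) ∂Q := by
    intro b
    refine tendsto_nhds_unique (hX.tendsto_charFun_noise hlam hZ b)
      ((tendsto_finsetProd Finset.univ fun j _ ↦
        (hD j).tendsto_charFun_noise hlam (hZD j) b).congr fun N ↦ ?_)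
    have := hX.charFun_noise_eq_prod hZ hD hZD {(N : ℝ≥0)} fun _ ↦ b
    simp only [Finset.sum_singleton, NNReal.coe_natCast] at this
    exact this.symm
  have hjoint : ∀ (I : Finset ℝ≥0) (u : ℝ≥0 → ℝ),
      ∫ ω, cexp ((∑ t ∈ I, u t * X t ω : ℝ) * Complex.I) ∂P =
        ∏ j, ∫ ω, cexp ((∑ t ∈ I, u t * D j t ω : ℝ) * Complex.I) ∂Q := by
    intro I u
    rw [hX.charFun_sum_eq_mul hZ, h0, hX.charFun_noise_eq_prod hZ hD hZD, ← Finset.prod_mul_distrib]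
    exact Finset.prod_congr rfl fun j _ ↦ ((hD j).charFun_sum_eq_mul (hZD j) I u).symm
  intro I
  have hXm : Measurable fun ω ↦ I.restrict (X · ω) :=
    measurable_pi_lambda _ fun t ↦ hX.measurable t
  have hDm : ∀ j, Measurable fun ω ↦ I.restrict (D j · ω) := fun j ↦
    measurable_pi_lambda _ fun t ↦ (hD j).measurable t
  have hSm : Measurable fun ω ↦ I.restrict fun t ↦ ∑ j, D j t ω :=
    measurable_pi_lambda _ fun t ↦ Finset.measurable_fun_sum _ fun j _ ↦ (hD j).measurable t
  refine ⟨hXm.aemeasurable, hSm.aemeasurable, ?_⟩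
  have := Measure.isProbabilityMeasure_map (μ := P) hXm.aemeasurable
  have := Measure.isProbabilityMeasure_map (μ := Q) hSm.aemeasurable
  have hS : (fun ω ↦ I.restrict fun t ↦ ∑ j, D j t ω) = fun ω ↦ ∑ j, I.restrict (D j · ω) := by
    ext ω t
    simp
  have hindI : iIndepFun (fun j ω ↦ I.restrict (D j · ω)) Q :=
    hind.comp (fun _ f ↦ I.restrict f) fun _ ↦ measurable_pi_lambda _ fun t ↦ measurable_pi_apply _
  refine Measure.ext_of_charFunDual (funext fun L ↦ ?_)
  rw [hS, hindI.charFunDual_map_fun_sum_eq_prod fun j ↦ (hDm j).aemeasurable, Finset.prod_apply]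
  obtain ⟨u, hL⟩ := exists_forall_restrict_eq_sum I L
  rw [charFunDual_map_restrict hXm hL, hjoint]
  exact Finset.prod_congr rfl fun j _ ↦ (charFunDual_map_restrict (hDm j) hL).symm

end Superposition

/-! ### Moments of linear combinations of Poisson variables -/

section PoissonMoments

lemma hasSum_poisson_mul_shift (r : ℝ) {F : ℕ → ℝ} {S : ℝ}
    (hF : HasSum (fun n : ℕ ↦ Real.exp (-r) * r ^ n / n.factorial * F n) S) :
    HasSum (fun n : ℕ ↦ Real.exp (-r) * r ^ n / n.factorial * (n * F (n - 1))) (r * S) := by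
  rw [← hasSum_nat_add_iff' 1]
  simp only [Finset.range_one, Finset.sum_singleton, Nat.cast_zero, zero_mul, mul_zero, sub_zero,
    Nat.add_sub_cancel]
  refine (hF.mul_left r).congr_fun fun n ↦ ?_
  rw [Nat.factorial_succ, pow_succ]
  have : ((n.factorial : ℕ) : ℝ) ≠ 0 := by positivity
  have : (n : ℝ) + 1 ≠ 0 := by positivity
  push_cast
  field_simp

lemma hasSum_poisson_mul_natCast (r : ℝ≥0) :
    HasSum (fun n : ℕ ↦ Real.exp (-r) * (r : ℝ) ^ n / n.factorial * n) r := by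
  have h := hasSum_poisson_mul_shift r (F := fun _ ↦ 1) (S := 1)
    (by simpa using hasSum_one_poissonMeasure r)
  simpa using h

lemma hasSum_poisson_mul_sq (r : ℝ≥0) :
    HasSum (fun n : ℕ ↦ Real.exp (-r) * (r : ℝ) ^ n / n.factorial * (n : ℝ) ^ 2)
      ((r : ℝ) ^ 2 + r) := by
  have h := (hasSum_poisson_mul_shift r (hasSum_poisson_mul_natCast r)).add
    (hasSum_poisson_mul_natCast r)
  rw [← sq] at h
  refine h.congr_fun fun n ↦ ?_
  cases n with
  | zero => simp
  | succ n =>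
    rw [Nat.add_sub_cancel]
    push_cast
    ring

lemma memLp_natCast_poissonMeasure (r : ℝ≥0) :
    MemLp (fun n : ℕ ↦ (n : ℝ)) 2 (poissonMeasure r) := by
  rw [memLp_two_iff_integrable_sq .of_discrete, integrable_poissonMeasure_iff]
  simpa using (hasSum_poisson_mul_sq r).summable

lemma integral_natCast_poissonMeasure (r : ℝ≥0) :
    ∫ n : ℕ, (n : ℝ) ∂(poissonMeasure r) = r := by
  rw [integral_poissonMeasure]
  exact (hasSum_poisson_mul_natCast r).tsum_eq

lemma variance_natCast_poissonMeasure (r : ℝ≥0) :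
    Var[fun n : ℕ ↦ (n : ℝ); poissonMeasure r] = r := by
  rw [variance_eq_sub (memLp_natCast_poissonMeasure r), integral_natCast_poissonMeasure,
    integral_poissonMeasure]
  have := (hasSum_poisson_mul_sq r).tsum_eq
  simp only [smul_eq_mul, Pi.pow_apply]
  rw [this]
  ring

/-- A random variable whose characteristic function is that of `∑ i, b i * N i`, with independent
Poisson variables `N i` of mean `r i`, has the first two moments of that sum. -/
lemma moments_of_charFun_eq {Ω : Type*} [MeasurableSpace Ω] {P : Measure Ω} [IsProbabilityMeasure P]
    {ι : Type*} [Fintype ι] {W : Ω → ℝ} (hW : Measurable W) (r : ι → ℝ≥0) (b : ι → ℝ)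
    (h : ∀ u : ℝ, ∫ ω, cexp ((u * W ω : ℝ) * I) ∂P =
      cexp (∑ i, (r i : ℂ) * (cexp ((u * b i : ℝ) * I) - 1))) :
    MemLp W 2 P ∧ ∫ ω, W ω ∂P = ∑ i, r i * b i ∧ Var[W; P] = ∑ i, r i * b i ^ 2 := by
  set μ : ι → Measure ℝ := fun i ↦ (poissonMeasure (r i)).map fun n : ℕ ↦ b i * (n : ℝ) with hμ
  have hbm : ∀ i, AEMeasurable (fun n : ℕ ↦ b i * (n : ℝ)) (poissonMeasure (r i)) :=
    fun i ↦ .of_discrete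
  have hμp : ∀ i, IsProbabilityMeasure (μ i) := fun i ↦
    Measure.isProbabilityMeasure_map (hbm i)
  have hchar : ∀ i u, charFun (μ i) u = cexp ((r i : ℂ) * (cexp ((u * b i : ℝ) * I) - 1)) := by
    intro i u
    rw [charFun_apply_real, hμ, integral_map (hbm i) (by fun_prop), ← integral_pow_poissonMeasure]
    refine integral_congr_ae (.of_forall fun n ↦ ?_)
    dsimp only
    rw [← Complex.exp_nat_mul]
    push_cast
    ring_nf
  have hSm : Measurable fun p : ι → ℝ ↦ ∑ i, p i :=
    Finset.measurable_fun_sum _ fun i _ ↦ measurable_pi_apply i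
  have hlaw : P.map W = (Measure.pi μ).map fun p ↦ ∑ i, p i := by
    have := Measure.isProbabilityMeasure_map (μ := P) hW.aemeasurable
    have := Measure.isProbabilityMeasure_map (μ := Measure.pi μ) hSm.aemeasurable
    refine Measure.ext_of_charFun (funext fun u ↦ ?_)
    rw [charFun_map_sum_pi_eq_prod, Finset.prod_apply, charFun_apply_real,
      integral_map hW.aemeasurable (by fun_prop)]
    simp only [hchar, ← Complex.exp_sum, ← h]
    push_cast
    rfl
  have hid : IdentDistrib W (fun p : ι → ℝ ↦ ∑ i, p i) P (Measure.pi μ) :=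
    ⟨hW.aemeasurable, hSm.aemeasurable, hlaw⟩
  have hL : ∀ i, MemLp id 2 (μ i) := fun i ↦ by
    rw [hμ, memLp_map_measure_iff (by fun_prop) (hbm i)]
    exact (memLp_natCast_poissonMeasure (r i)).const_mul (b i)
  have hLe : ∀ i, MemLp (fun p : ι → ℝ ↦ p i) 2 (Measure.pi μ) := fun i ↦
    (hL i).comp_measurePreserving (measurePreserving_eval μ i)
  refine ⟨hid.memLp_iff.2 (memLp_finsetSum _ fun i _ ↦ hLe i), ?_, ?_⟩
  · rw [hid.integral_eq, integral_finsetSum _ fun i _ ↦ (hLe i).integrable one_le_two]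
    refine Finset.sum_congr rfl fun i _ ↦ ?_
    have h1 := integral_comp_eval (μ := μ) (i := i) (f := fun x : ℝ ↦ x) (by fun_prop)
    rw [h1, hμ, integral_map (hbm i) (by fun_prop), integral_const_mul,
      integral_natCast_poissonMeasure, mul_comm]
  · have hv := variance_sum_pi (X := fun _ : ι ↦ (id : ℝ → ℝ)) hL
    have hfun : (∑ i, fun p : ι → ℝ ↦ id (p i)) = fun p ↦ ∑ i, p i := by
      ext p
      simp
    rw [hfun] at hv
    rw [hid.variance_eq, hv]
    refine Finset.sum_congr rfl fun i _ ↦ ?_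
    rw [hμ, variance_map (by fun_prop) (hbm i)]
    change Var[fun n : ℕ ↦ b i * (n : ℝ); poissonMeasure (r i)] = _
    rw [variance_const_mul, variance_natCast_poissonMeasure, mul_comm]

end PoissonMoments

/-! ### Moments of the noise -/

section NoiseMoments

variable {Ω : Type*} [MeasurableSpace Ω] {P : Measure Ω} {lam θ : ℝ≥0}
  {Z X : ℝ≥0 → Ω → ℝ} {ι : Type*} [Fintype ι] {b : ι → ℝ}

/-- First and second moments of weighted sums of increments along a regular grid, for a driver with
jumps of the sizes `b j`, each at rate `θ`. -/
lemma IsSubordinator.moments_weighted_sum [IsProbabilityMeasure P]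
    (hZ : IsSubordinator (fun u ↦ ∑ j, poissonExponent θ (b j) u) Z P) (δ : ℝ≥0) (m : ℕ)
    (w : ℕ → ℝ) :
    let W : Ω → ℝ := fun ω ↦ ∑ i ∈ Finset.range m,
      w i * (Z (((i + 1 : ℕ) : ℝ≥0) * δ) ω - Z ((i : ℝ≥0) * δ) ω)
    MemLp W 2 P ∧ ∫ ω, W ω ∂P = (θ * ∑ j, b j) * ∑ i ∈ Finset.range m, w i * δ ∧
      Var[W; P] = (θ * ∑ j, b j ^ 2) * ∑ i ∈ Finset.range m, w i ^ 2 * δ := by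
  intro W
  have hW : Measurable W := Finset.measurable_fun_sum _ fun i _ ↦
    ((hZ.measurable _).fun_sub (hZ.measurable _)).const_mul _
  have h := moments_of_charFun_eq (P := P) hW (fun _ : Fin m × ι ↦ δ * θ) (fun p ↦ w p.1 * b p.2)
    (fun u ↦ ?_)
  · refine ⟨h.1, h.2.1.trans ?_, h.2.2.trans ?_⟩
    · rw [Fintype.sum_prod_type, Finset.sum_range, Finset.mul_sum]
      refine Finset.sum_congr rfl fun i _ ↦ ?_
      rw [mul_assoc, Finset.sum_mul, Finset.mul_sum]
      refine Finset.sum_congr rfl fun j _ ↦ ?_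
      push_cast
      ring
    · rw [Fintype.sum_prod_type, Finset.sum_range, Finset.mul_sum]
      refine Finset.sum_congr rfl fun i _ ↦ ?_
      rw [mul_assoc, Finset.sum_mul, Finset.mul_sum]
      refine Finset.sum_congr rfl fun j _ ↦ ?_
      push_cast
      ring
  · have hc := hZ.charFun_grid δ m fun i ↦ u * w i
    have hfun : ∀ ω, u * W ω = ∑ i ∈ Finset.range m,
        u * w i * (Z (((i + 1 : ℕ) : ℝ≥0) * δ) ω - Z ((i : ℝ≥0) * δ) ω) := by
      intro ω
      rw [Finset.mul_sum]
      exact Finset.sum_congr rfl fun i _ ↦ (mul_assoc _ _ _).symm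
    simp_rw [hfun]
    rw [hc, Fintype.sum_prod_type, Finset.sum_range, Finset.mul_sum]
    congr 1
    refine Finset.sum_congr rfl fun i _ ↦ ?_
    rw [Finset.mul_sum]
    refine Finset.sum_congr rfl fun j _ ↦ ?_
    rw [poissonExponent]
    push_cast
    ring_nf

/-- The Riemann sums of an exponential kernel. They are the sums of `tendsto_riemann_sum` for
the deterministic solution `x t = 1 - e^{-κ t}` with driver `v t = κ t`. -/
lemma tendsto_riemann_sum_exp {κ t : ℝ} (hκ : 0 ≤ κ) (ht : 0 ≤ t) :
    Tendsto (fun n : ℕ ↦ ∑ i ∈ Finset.range ⌈t * (n + 1)⌉₊,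
      Real.exp (-(κ * (t - i / (n + 1)))) * (κ / (n + 1))) atTop (𝓝 (1 - Real.exp (-(κ * t)))) := by
  have hder : ∀ s : ℝ, HasDerivAt (fun s ↦ -Real.exp (-(κ * s))) (κ * Real.exp (-(κ * s))) s := by
    intro s
    have := (((hasDerivAt_id s).const_mul κ).fun_neg.exp).fun_neg
    simpa [mul_comm] using this
  have h := tendsto_riemann_sum (x := fun s ↦ 1 - Real.exp (-(κ * s))) (v := fun s ↦ κ * s)
    (lam := κ) (fun a _ b _ hab ↦ by dsimp only; gcongr) (fun t _ ↦ by fun_prop)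
    (fun t ht ↦ ?_) hκ ht
  · simp only [mul_zero, neg_zero, Real.exp_zero, sub_self, sub_zero] at h
    refine h.congr fun n ↦ Finset.sum_congr rfl fun i _ ↦ ?_
    push_cast
    ring
  · refine ⟨Continuous.intervalIntegrable (by fun_prop) _ _, ?_⟩
    have hI : κ * ∫ s in (0 : ℝ)..t, (1 - Real.exp (-(κ * s))) =
        κ * t + Real.exp (-(κ * t)) - 1 := by
      rw [intervalIntegral.integral_sub (by simp) (Continuous.intervalIntegrable (by fun_prop) _ _),
        mul_sub, ← intervalIntegral.integral_const_mul κ (fun s ↦ Real.exp (-(κ * s))),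
        intervalIntegral.integral_eq_sub_of_hasDerivAt (fun s _ ↦ hder s)
          (Continuous.intervalIntegrable (by fun_prop) _ _)]
      simp
      ring
    rw [hI]
    simp
    ring

lemma ouWeight_nonneg (lam t : ℝ≥0) (n i : ℕ) : 0 ≤ ouWeight lam t n i := by
  unfold ouWeight
  split_ifs <;> positivity

lemma ouWeight_le_one (lam t : ℝ≥0) (n i : ℕ) : ouWeight lam t n i ≤ 1 := by
  unfold ouWeight
  split_ifs with h
  · have h1 := Nat.lt_ceil.1 h
    have h2 : (i : ℝ) / (n + 1) ≤ t := by
      rw [div_le_iff₀ (by positivity)]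
      exact h1.le
    have : 0 ≤ (lam : ℝ) * ((t : ℝ) - i / (n + 1)) := mul_nonneg lam.coe_nonneg (by linarith)
    rw [Real.exp_le_one_iff]
    linarith
  · exact zero_le_one

/-- The Riemann sums for the noise up to time `t` are dominated by an increment of the driver. -/
lemma IsSubordinator.ae_riemann_sum_mem_Icc {g : ℝ → ℂ} (hZ : IsSubordinator g Z P) (lam t : ℝ≥0) :
    ∀ᵐ ω ∂P, ∀ n : ℕ, ∑ i ∈ Finset.range ⌈(t : ℝ) * (n + 1)⌉₊,
      ouWeight lam t n i * gridIncrement lam Z n i ω ∈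
        Set.Icc 0 (Z (lam * (t + 1)) ω - Z 0 ω) := by
  filter_upwards [hZ.paths] with ω hω n
  have hnn : ∀ i, 0 ≤ gridIncrement lam Z n i ω := fun i ↦
    sub_nonneg.2 (hω.1 (monotone_grid _ (Nat.le_succ i)))
  refine ⟨Finset.sum_nonneg fun i _ ↦ mul_nonneg (ouWeight_nonneg _ _ _ _) (hnn i), ?_⟩
  calc ∑ i ∈ Finset.range ⌈(t : ℝ) * (n + 1)⌉₊, ouWeight lam t n i * gridIncrement lam Z n i ω
      ≤ ∑ i ∈ Finset.range ⌈(t : ℝ) * (n + 1)⌉₊, gridIncrement lam Z n i ω :=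
        Finset.sum_le_sum fun i _ ↦ mul_le_of_le_one_left (hnn i) (ouWeight_le_one _ _ _ _)
    _ = Z ((⌈(t : ℝ) * (n + 1)⌉₊ : ℝ≥0) * (lam / (n + 1))) ω - Z 0 ω := by
        have := Finset.sum_range_sub (fun i : ℕ ↦ Z ((i : ℝ≥0) * (lam / (n + 1))) ω)
          ⌈(t : ℝ) * (n + 1)⌉₊
        simp only [Nat.cast_zero, zero_mul] at this
        exact this
    _ ≤ Z (lam * (t + 1)) ω - Z 0 ω := by
        refine sub_le_sub_right (hω.1 ?_) _
        have h := ceil_div_le_add_one n t.coe_nonneg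
        have h' : (⌈(t : ℝ) * (n + 1)⌉₊ : ℝ≥0) / (n + 1) ≤ t + 1 := by exact_mod_cast h
        calc (⌈(t : ℝ) * (n + 1)⌉₊ : ℝ≥0) * (lam / (n + 1))
            = lam * ((⌈(t : ℝ) * (n + 1)⌉₊ : ℝ≥0) / (n + 1)) := by ring
          _ ≤ lam * (t + 1) := by gcongr

/-- Mean and variance of the noise `X t - e^{-lam t} X 0`. -/
lemma IsStationaryOU.moments_noise [IsProbabilityMeasure P] (hX : IsStationaryOU lam Z X P)
    (hZ : IsSubordinator (fun u ↦ ∑ j, poissonExponent θ (b j) u) Z P) (t : ℝ≥0) :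
    let W : Ω → ℝ := fun ω ↦ X t ω - Real.exp (-(lam * t)) * X 0 ω
    MemLp W 2 P ∧ ∫ ω, W ω ∂P = (θ * ∑ j, b j) * (1 - Real.exp (-(lam * t))) ∧
      Var[W; P] = (θ * ∑ j, b j ^ 2) / 2 * (1 - Real.exp (-(2 * lam * t))) := by
  intro W
  have hWm : Measurable W := (hX.measurable t).sub ((hX.measurable 0).const_mul _)
  set R : ℕ → Ω → ℝ := fun n ω ↦ ∑ i ∈ Finset.range ⌈(t : ℝ) * (n + 1)⌉₊,
    ouWeight lam t n i * gridIncrement lam Z n i ω with hR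
  set G : Ω → ℝ := fun ω ↦ Z (lam * (t + 1)) ω - Z 0 ω with hG
  have hRmom := fun n : ℕ ↦ hZ.moments_weighted_sum (lam / (n + 1)) ⌈(t : ℝ) * (n + 1)⌉₊
    (ouWeight lam t n)
  have hGL : MemLp G 2 P := by
    simpa using (hZ.moments_weighted_sum (lam * (t + 1)) 1 fun _ ↦ 1).1
  have hRW : ∀ᵐ ω ∂P, Tendsto (fun n ↦ R n ω) atTop (𝓝 (W ω)) := by
    filter_upwards [hX.ae_tendsto_riemann_sum hZ] with ω hω using hω t
  have hRb := hZ.ae_riemann_sum_mem_Icc lam t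
  have hRL : ∀ n, MemLp (R n) 2 P := fun n ↦ (hRmom n).1
  have hWL : MemLp W 2 P := by
    refine hGL.mono hWm.aestronglyMeasurable ?_
    filter_upwards [hRW, hRb] with ω h1 h2
    have h3 : W ω ∈ Set.Icc 0 (G ω) := isClosed_Icc.mem_of_tendsto h1 (.of_forall h2)
    rw [Real.norm_of_nonneg h3.1, Real.norm_of_nonneg (h3.1.trans h3.2)]
    exact h3.2
  have hlim1 : Tendsto (fun n ↦ ∫ ω, R n ω ∂P) atTop (𝓝 (∫ ω, W ω ∂P)) := by
    refine tendsto_integral_of_dominated_convergence G (fun n ↦ (hRL n).1)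
      (hGL.integrable one_le_two) (fun n ↦ ?_) hRW
    filter_upwards [hRb] with ω h2
    rw [Real.norm_of_nonneg (h2 n).1]
    exact (h2 n).2
  have hlim2 : Tendsto (fun n ↦ ∫ ω, R n ω ^ 2 ∂P) atTop (𝓝 (∫ ω, W ω ^ 2 ∂P)) := by
    refine tendsto_integral_of_dominated_convergence (fun ω ↦ G ω ^ 2) (fun n ↦ (hRL n).1.pow 2)
      hGL.integrable_sq (fun n ↦ ?_) ?_
    · filter_upwards [hRb] with ω h2
      rw [norm_pow, Real.norm_of_nonneg (h2 n).1]
      exact pow_le_pow_left₀ (h2 n).1 (h2 n).2 2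
    · filter_upwards [hRW] with ω h1 using h1.pow 2
  have hlimV : Tendsto (fun n ↦ Var[R n; P]) atTop (𝓝 Var[W; P]) := by
    rw [variance_eq_sub hWL]
    refine (hlim2.sub (hlim1.pow 2)).congr fun n ↦ ?_
    rw [variance_eq_sub (hRL n)]
    rfl
  have hk1 := tendsto_riemann_sum_exp lam.coe_nonneg t.coe_nonneg
  have hk2 := tendsto_riemann_sum_exp (κ := 2 * lam) (by positivity) t.coe_nonneg
  refine ⟨hWL, tendsto_nhds_unique hlim1 ((hk1.const_mul (θ * ∑ j, b j)).congr fun n ↦ ?_),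
    tendsto_nhds_unique hlimV ((hk2.const_mul ((θ * ∑ j, b j ^ 2) / 2)).congr fun n ↦ ?_)⟩
  · refine Eq.trans ?_ (hRmom n).2.1.symm
    congr 1
    refine Finset.sum_congr rfl fun i hi ↦ ?_
    rw [ouWeight, if_pos (Finset.mem_range.1 hi)]
    push_cast
    rfl
  · refine Eq.trans ?_ (hRmom n).2.2.symm
    rw [div_mul_eq_mul_div, mul_div_assoc, Finset.sum_div]
    congr 1
    refine Finset.sum_congr rfl fun i hi ↦ ?_
    rw [ouWeight, if_pos (Finset.mem_range.1 hi), ← Real.exp_nat_mul]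
    push_cast
    ring_nf

end NoiseMoments

/-! ### Moments of the stationary solution -/

section StationaryMoments

variable {Ω : Type*} [MeasurableSpace Ω] {P : Measure Ω} {lam θ : ℝ≥0}
  {Z X : ℝ≥0 → Ω → ℝ} {ι : Type*} [Fintype ι] {b : ι → ℝ}

lemma IsStationaryOU.indepFun_noise [IsProbabilityMeasure P] {g : ℝ → ℂ}
    (hX : IsStationaryOU lam Z X P) (hZ : IsSubordinator g Z P) (t : ℝ≥0) :
    IndepFun (X 0) (fun ω ↦ X t ω - Real.exp (-(lam * t)) * X 0 ω) P := by
  have hWm : Measurable fun ω ↦ X t ω - Real.exp (-(lam * t)) * X 0 ω :=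
    (hX.measurable t).sub ((hX.measurable 0).const_mul _)
  refine (indepFun_iff_charFunDual_prod (hX.measurable 0).aemeasurable hWm.aemeasurable).2
    fun L ↦ ?_
  have hL : ∀ x y : ℝ, L (x, y) = L (1, 0) * x + L (0, 1) * y := by
    intro x y
    have h : ((x, y) : ℝ × ℝ) = x • ((1 : ℝ), (0 : ℝ)) + y • ((0 : ℝ), (1 : ℝ)) := by simp
    rw [h, map_add, map_smul, map_smul, smul_eq_mul, smul_eq_mul, mul_comm x, mul_comm y]
  have hx : ∀ x : ℝ, L (x, 0) = L (1, 0) * x := fun x ↦ by rw [hL x 0, mul_zero, add_zero]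
  have hy : ∀ y : ℝ, L (0, y) = L (0, 1) * y := fun y ↦ by rw [hL 0 y, mul_zero, zero_add]
  have h := hX.charFun_eq_mul hZ {t} (fun _ ↦ L (0, 1)) (L (1, 0))
  simp only [Finset.sum_singleton] at h
  rw [charFunDual_apply, charFunDual_apply, charFunDual_apply,
    integral_map ((hX.measurable 0).prodMk hWm).aemeasurable
      (Measurable.aestronglyMeasurable (by fun_prop)),
    integral_map (hX.measurable 0).aemeasurable (Measurable.aestronglyMeasurable (by fun_prop)),
    integral_map hWm.aemeasurable (Measurable.aestronglyMeasurable (by fun_prop))]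
  simp only [ContinuousLinearMap.comp_apply, ContinuousLinearMap.inl_apply,
    ContinuousLinearMap.inr_apply]
  have e1 : ∀ ω, L (X 0 ω, X t ω - Real.exp (-(lam * t)) * X 0 ω) = _ := fun ω ↦ hL _ _
  have e2 : ∀ x : ℝ, cexp (L (x, 0) * I) = cexp ((L (1, 0) * x : ℝ) * I) := fun x ↦ by rw [hx]
  have e3 : ∀ y : ℝ, cexp (L (0, y) * I) = cexp ((L (0, 1) * y : ℝ) * I) := fun y ↦ by rw [hy]
  simp_rw [e1]
  rw [h]
  exact congrArg₂ _ (integral_congr_ae (.of_forall fun ω ↦ (e2 _).symm))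
    (integral_congr_ae (.of_forall fun ω ↦ (e3 _).symm))

lemma IsStrictlyStationary.identDistrib_zero (hX : IsStrictlyStationary X P) (t : ℝ≥0) :
    IdentDistrib (X t) (X 0) P P := by
  have h := (hX t {0}).comp (u := fun y : ({0} : Finset ℝ≥0) → ℝ ↦ y ⟨0, by simp⟩)
    (measurable_pi_apply _)
  simpa [Function.comp_def] using h

lemma IsStrictlyStationary.identDistrib_pair (hX : IsStrictlyStationary X P) (t τ : ℝ≥0) :
    IdentDistrib (fun ω ↦ (X t ω, X (t + τ) ω)) (fun ω ↦ (X 0 ω, X τ ω)) P P := by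
  have h := (hX t {0, τ}).comp
    (u := fun y : ({0, τ} : Finset ℝ≥0) → ℝ ↦ (y ⟨0, by simp⟩, y ⟨τ, by simp⟩))
    ((measurable_pi_apply _).prodMk (measurable_pi_apply _))
  simpa [Function.comp_def, add_comm t τ] using h

/-- A random variable is integrable if its truncations have bounded expectations. -/
lemma integrable_of_integral_min_le [IsFiniteMeasure P] {f : Ω → ℝ} (hf : Measurable f)
    (hf0 : ∀ ω, 0 ≤ f ω) {K : ℝ} (hK : ∀ M : ℕ, ∫ ω, min (f ω) M ∂P ≤ K) : Integrable f P := by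
  refine ⟨hf.aestronglyMeasurable, ?_⟩
  have hlim : ∀ ω, Tendsto (fun M : ℕ ↦ ENNReal.ofReal (min (f ω) M)) atTop
      (𝓝 (ENNReal.ofReal (f ω))) := by
    intro ω
    refine tendsto_const_nhds.congr' ?_
    filter_upwards [eventually_ge_atTop ⌈f ω⌉₊] with M hM
    rw [min_eq_left (Nat.ceil_le.1 hM)]
  have hle : ∀ M : ℕ, ∫⁻ ω, ENNReal.ofReal (min (f ω) M) ∂P ≤ ENNReal.ofReal K := by
    intro M
    have h0 : ∀ ω, 0 ≤ min (f ω) M := fun ω ↦ le_min (hf0 ω) (Nat.cast_nonneg M)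
    have hint : Integrable (fun ω ↦ min (f ω) M) P := by
      refine Integrable.of_bound (hf.min measurable_const).aestronglyMeasurable M
        (.of_forall fun ω ↦ ?_)
      rw [Real.norm_of_nonneg (h0 ω)]
      exact min_le_right _ _
    rw [← ofReal_integral_eq_lintegral_ofReal hint (.of_forall h0)]
    exact ENNReal.ofReal_le_ofReal (hK M)
  rw [hasFiniteIntegral_iff_ofReal (.of_forall hf0)]
  refine lt_of_le_of_lt ?_ (ENNReal.ofReal_lt_top (r := K))
  calc ∫⁻ ω, ENNReal.ofReal (f ω) ∂P
      = ∫⁻ ω, liminf (fun M : ℕ ↦ ENNReal.ofReal (min (f ω) M)) atTop ∂P :=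
        lintegral_congr fun ω ↦ ((hlim ω).liminf_eq).symm
    _ ≤ liminf (fun M : ℕ ↦ ∫⁻ ω, ENNReal.ofReal (min (f ω) M) ∂P) atTop :=
        lintegral_liminf_le fun M ↦ (hf.min measurable_const).ennreal_ofReal
    _ ≤ liminf (fun _ : ℕ ↦ ENNReal.ofReal K) atTop := liminf_le_liminf (.of_forall hle)
    _ = ENNReal.ofReal K := by simp

/-- The noise has second moments bounded uniformly in time, and the initial value is forgotten;
by stationarity the truncated second moments of `X 0` are bounded. -/
lemma IsStationaryOU.memLp_zero [IsProbabilityMeasure P] (hlam : 0 < lam)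
    (hX : IsStationaryOU lam Z X P)
    (hZ : IsSubordinator (fun u ↦ ∑ j, poissonExponent θ (b j) u) Z P) : MemLp (X 0) 2 P := by
  set K : ℝ := (θ * ∑ j, b j) ^ 2 + (θ * ∑ j, b j ^ 2) / 2 with hK
  set ρ : ℕ → ℝ := fun N ↦ Real.exp (-(lam * (N : ℝ))) with hρ
  have hρ0 : Tendsto ρ atTop (𝓝 0) := Real.tendsto_exp_neg_atTop_nhds_zero.comp
    (tendsto_natCast_atTop_atTop.const_mul_atTop (by exact_mod_cast hlam))
  have hm0 := hX.measurable 0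
  have hWL : ∀ N : ℕ, MemLp (fun ω ↦ X N ω - ρ N * X 0 ω) 2 P := fun N ↦
    (hX.moments_noise hZ N).1
  have hW2 : ∀ N : ℕ, ∫ ω, (X N ω - ρ N * X 0 ω) ^ 2 ∂P ≤ K := by
    intro N
    obtain ⟨h1, h2, h3⟩ := hX.moments_noise hZ N
    have h4 := variance_eq_sub h1
    have h5 : ∫ ω, (X N ω - ρ N * X 0 ω) ^ 2 ∂P =
        (θ * ∑ j, b j ^ 2) / 2 * (1 - Real.exp (-(2 * lam * (N : ℝ≥0)))) +
          ((θ * ∑ j, b j) * (1 - Real.exp (-(lam * (N : ℝ≥0))))) ^ 2 := by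
      rw [← h2, ← h3, h4]
      simp [hρ]
    have he : ∀ y : ℝ, 0 ≤ y → 0 ≤ 1 - Real.exp (-y) ∧ 1 - Real.exp (-y) ≤ 1 := fun y hy ↦
      ⟨sub_nonneg.2 (Real.exp_le_one_iff.2 (by linarith)), by linarith [Real.exp_pos (-y)]⟩
    have e1 := he (lam * (N : ℝ≥0)) (by positivity)
    have e2 := he (2 * lam * (N : ℝ≥0)) (by positivity)
    rw [h5, hK, mul_pow, add_comm]
    refine add_le_add (mul_le_of_le_one_right (sq_nonneg _) (pow_le_one₀ e1.1 e1.2))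
      (mul_le_of_le_one_right ?_ e2.2)
    have : 0 ≤ ∑ j, b j ^ 2 := Finset.sum_nonneg fun j _ ↦ sq_nonneg _
    positivity
  have hbd : ∀ (M : ℕ) (N : ℕ), ∫ ω, min (X 0 ω ^ 2) (M : ℝ) ∂P ≤
      ∫ ω, min (2 * (ρ N * X 0 ω) ^ 2) (M : ℝ) ∂P + 2 * K := by
    intro M N
    have hstat : ∫ ω, min (X 0 ω ^ 2) (M : ℝ) ∂P = ∫ ω, min (X N ω ^ 2) (M : ℝ) ∂P :=
      (((hX.stationary.identDistrib_zero N).comp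
        (u := fun y : ℝ ↦ min (y ^ 2) (M : ℝ)) (by fun_prop)).integral_eq).symm
    have hint : ∀ {f : Ω → ℝ}, Measurable f → (∀ ω, 0 ≤ f ω) →
        Integrable (fun ω ↦ min (f ω) (M : ℝ)) P := by
      intro f hf hf0
      refine Integrable.of_bound (hf.min measurable_const).aestronglyMeasurable M
        (.of_forall fun ω ↦ ?_)
      rw [Real.norm_of_nonneg (le_min (hf0 ω) (Nat.cast_nonneg M))]
      exact min_le_right _ _
    have hi1 := hint ((hX.measurable N).pow_const 2) fun ω ↦ sq_nonneg _
    have hi2 := hint (((hm0.const_mul (ρ N)).pow_const 2).const_mul 2) fun ω ↦ by positivity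
    have hi3 := (hWL N).integrable_sq.const_mul 2
    calc ∫ ω, min (X 0 ω ^ 2) (M : ℝ) ∂P = ∫ ω, min (X N ω ^ 2) (M : ℝ) ∂P := hstat
      _ ≤ ∫ ω, (min (2 * (ρ N * X 0 ω) ^ 2) (M : ℝ) + 2 * (X N ω - ρ N * X 0 ω) ^ 2) ∂P := by
          refine integral_mono hi1 (hi2.add hi3) fun ω ↦ ?_
          have hsq : X N ω ^ 2 ≤ 2 * (ρ N * X 0 ω) ^ 2 + 2 * (X N ω - ρ N * X 0 ω) ^ 2 := by
            nlinarith [sq_nonneg (X N ω - 2 * (ρ N * X 0 ω))]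
          rw [← min_add_add_right]
          exact min_le_min hsq (by nlinarith [sq_nonneg (X N ω - ρ N * X 0 ω)])
      _ = ∫ ω, min (2 * (ρ N * X 0 ω) ^ 2) (M : ℝ) ∂P +
          2 * ∫ ω, (X N ω - ρ N * X 0 ω) ^ 2 ∂P := by
          rw [integral_add hi2 hi3, integral_const_mul]
      _ ≤ ∫ ω, min (2 * (ρ N * X 0 ω) ^ 2) (M : ℝ) ∂P + 2 * K := by
          gcongr
          exact hW2 N
  have hlim : ∀ M : ℕ, Tendsto (fun N ↦ ∫ ω, min (2 * (ρ N * X 0 ω) ^ 2) (M : ℝ) ∂P) atTop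
      (𝓝 0) := by
    intro M
    suffices h : Tendsto (fun N ↦ ∫ ω, min (2 * (ρ N * X 0 ω) ^ 2) (M : ℝ) ∂P) atTop
        (𝓝 (∫ _, (0 : ℝ) ∂P)) by simpa using h
    refine tendsto_integral_of_dominated_convergence (fun _ ↦ (M : ℝ))
      (fun N ↦ ((((hm0.const_mul (ρ N)).pow_const 2).const_mul 2).min
        measurable_const).aestronglyMeasurable) (integrable_const _)
      (fun N ↦ .of_forall fun ω ↦ ?_) (.of_forall fun ω ↦ ?_)
    · rw [Real.norm_of_nonneg (le_min (by positivity) (Nat.cast_nonneg M))]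
      exact min_le_right _ _
    · have := ((((hρ0.mul_const (X 0 ω)).pow 2).const_mul 2).min
        (tendsto_const_nhds (x := (M : ℝ))))
      simpa using this
  rw [memLp_two_iff_integrable_sq hm0.aestronglyMeasurable]
  refine integrable_of_integral_min_le (hm0.pow_const 2) (fun ω ↦ sq_nonneg _) (K := 2 * K)
    fun M ↦ ?_
  simpa using ge_of_tendsto' ((hlim M).add_const (2 * K)) fun N ↦ hbd M N

/-- Moments of a stationary solution whose driver has jumps of the sizes `b j`, each at rate `θ`.
Mean and variance of `X 0` are the fixed points of the affine recursions given by
`X 1 = e^{-lam} X 0 + W` with `W` independent of `X 0`. -/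
lemma IsStationaryOU.moments [IsProbabilityMeasure P] (hlam : 0 < lam)
    (hX : IsStationaryOU lam Z X P)
    (hZ : IsSubordinator (fun u ↦ ∑ j, poissonExponent θ (b j) u) Z P) :
    (∀ t, MemLp (X t) 2 P) ∧ (∀ t, ∫ ω, X t ω ∂P = θ * ∑ j, b j) ∧
      ∀ t τ : ℝ≥0, cov[X t, X (t + τ); P] =
        (θ * ∑ j, b j ^ 2) / 2 * Real.exp (-(lam * τ)) := by
  have h0 := hX.memLp_zero hlam hZ
  have hst := hX.stationary.identDistrib_zero
  have hL : ∀ t, MemLp (X t) 2 P := fun t ↦ (hst t).memLp_iff.2 h0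
  have hdecomp : ∀ t : ℝ≥0, X t = (fun ω ↦ Real.exp (-(lam * t)) * X 0 ω) +
      fun ω ↦ X t ω - Real.exp (-(lam * t)) * X 0 ω := by
    intro t
    ext ω
    simp
  have hL0 : ∀ t : ℝ≥0, MemLp (fun ω ↦ Real.exp (-(lam * t)) * X 0 ω) 2 P := fun t ↦
    h0.const_mul _
  obtain ⟨hW, hWE, hWV⟩ := hX.moments_noise hZ 1
  have hlt : Real.exp (-lam) < 1 := Real.exp_lt_one_iff.2 (by simpa using hlam)
  have hlt2 : Real.exp (-(2 * lam)) < 1 := Real.exp_lt_one_iff.2 (by simpa using hlam)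
  simp only [NNReal.coe_one, mul_one] at hW hWE hWV
  have hmean : ∫ ω, X 0 ω ∂P = θ * ∑ j, b j := by
    have h1 : ∫ ω, (X 1 ω - Real.exp (-lam) * X 0 ω) ∂P =
        ∫ ω, X 0 ω ∂P - Real.exp (-lam) * ∫ ω, X 0 ω ∂P := by
      rw [integral_sub ((hL 1).integrable one_le_two)
        ((h0.const_mul _).integrable one_le_two), integral_const_mul, (hst 1).integral_eq]
    rw [h1] at hWE
    have h2 : (1 - Real.exp (-lam)) ≠ 0 := by linarith
    apply mul_right_cancel₀ h2
    linarith
  have hvar : Var[X 0; P] = (θ * ∑ j, b j ^ 2) / 2 := by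
    have hind := hX.indepFun_noise hZ 1
    have hind' := hind.comp (measurable_id.const_mul (Real.exp (-lam))) measurable_id
    have h1 : Var[X 1; P] = Real.exp (-lam) ^ 2 * Var[X 0; P] +
        Var[fun ω ↦ X 1 ω - Real.exp (-lam) * X 0 ω; P] := by
      have hd := hdecomp 1
      simp only [NNReal.coe_one, mul_one] at hd hind'
      conv_lhs => rw [hd]
      rw [IndepFun.variance_add (h0.const_mul _) hW hind', variance_const_mul]
    rw [(hst 1).variance_eq, hWV, ← Real.exp_nat_mul] at h1
    have h2 : (1 - Real.exp (-(2 * lam))) ≠ 0 := by linarith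
    apply mul_right_cancel₀ h2
    have h3 : ((2 : ℕ) : ℝ) * -(lam : ℝ) = -(2 * lam) := by push_cast; ring
    rw [h3] at h1
    linarith
  refine ⟨hL, fun t ↦ (hst t).integral_eq.trans hmean, fun t τ ↦ ?_⟩
  have hprod : ∫ ω, X t ω * X (t + τ) ω ∂P = ∫ ω, X 0 ω * X τ ω ∂P :=
    ((hX.stationary.identDistrib_pair t τ).comp (u := fun p : ℝ × ℝ ↦ p.1 * p.2)
      (by fun_prop)).integral_eq
  have hcov : cov[X t, X (t + τ); P] = cov[X 0, X τ; P] := by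
    rw [covariance_eq_sub (hL t) (hL _), covariance_eq_sub h0 (hL τ), (hst t).integral_eq,
      (hst (t + τ)).integral_eq, (hst τ).integral_eq]
    simp only [Pi.mul_apply]
    rw [hprod]
  have hWτ := (hX.moments_noise hZ τ).1
  rw [hcov, hdecomp τ, covariance_add_right h0 (hL0 τ) hWτ, covariance_const_mul_right,
    covariance_self (hX.measurable 0).aemeasurable, hvar,
    (hX.indepFun_noise hZ τ).covariance_eq_zero h0 hWτ]
  ring

end StationaryMoments

/-! ### The sums `1 + ⋯ + k` and `1² + ⋯ + k²` -/

lemma sum_fin_add_one (k : ℕ) : ∑ j : Fin k, ((j : ℝ) + 1) = (k : ℝ) * (k + 1) / 2 := by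
  induction k with
  | zero => simp
  | succ k ih =>
    rw [Fin.sum_univ_castSucc]
    simp only [Fin.val_castSucc, ih, Fin.val_last]
    push_cast
    ring

lemma sum_fin_add_one_sq (k : ℕ) :
    ∑ j : Fin k, ((j : ℝ) + 1) ^ 2 = (k : ℝ) * (k + 1) * (2 * k + 1) / 6 := by
  induction k with
  | zero => simp
  | succ k ih =>
    rw [Fin.sum_univ_castSucc]
    simp only [Fin.val_castSucc, ih, Fin.val_last]
    push_cast
    ring

end DickmanOU

theorem theorem3p2 {Ω : Type*} [MeasurableSpace Ω] (P : Measure Ω) [IsProbabilityMeasure P]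
    (k : ℕ) (hk : 1 ≤ k) (lam θ : ℝ≥0) (hlam : 0 < lam) (hθ : 0 < θ)
    (Z X : ℝ≥0 → Ω → ℝ)
    (hZ : DickmanOU.IsPoissonProcessOfOrder k θ Z P)
    (hX : DickmanOU.IsStationaryOU lam Z X P) :
    (∀ {Ω' : Type*} [MeasurableSpace Ω'] (Q : Measure Ω') [IsProbabilityMeasure Q]
        (D : Fin k → ℝ≥0 → Ω' → ℝ),
        (∀ j : Fin k, DickmanOU.IsDOU lam θ ((j : ℝ) + 1) (D j) Q) →
        iIndepFun (fun (j : Fin k) (ω : Ω') (t : ℝ≥0) ↦ D j t ω) Q →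
        DickmanOU.SameFDD X P (fun t ω ↦ ∑ j, D j t ω) Q) ∧
    (∀ t : ℝ≥0, MemLp (X t) 2 P) ∧
    (∀ t : ℝ≥0, ∫ ω, X t ω ∂P = (θ : ℝ) * ((k : ℝ) * ((k : ℝ) + 1) / 2)) ∧
    (∀ t τ : ℝ≥0, covariance (X t) (X (t + τ)) P =
      (θ : ℝ) / 2 * ((k : ℝ) * ((k : ℝ) + 1) * (2 * (k : ℝ) + 1) / 6) *
        Real.exp (-((lam : ℝ) * (τ : ℝ)))) := by
  have hsub := hZ.isSubordinator hk
  obtain ⟨hL, hE, hC⟩ := hX.moments (b := fun j : Fin k ↦ (j : ℝ) + 1) hlam hsub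
  refine ⟨fun {Ω'} _ Q _ D hD hind ↦ ?_, hL, fun t ↦ ?_, fun t τ ↦ ?_⟩
  · choose N hN hD' using hD
    exact hX.sameFDD_sum hlam hsub hD' (fun j ↦ (hN j).isSubordinator (by positivity)) hind
  · rw [hE, DickmanOU.sum_fin_add_one]
  · rw [hC, DickmanOU.sum_fin_add_one_sq]
    ring
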